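/- **Setting.** Let $\eta$ be the metric of signature $(-1,1,1)$ on $\mathbb R^3$ (Minkowski space $M^{2,1}$). Let $\gamma(t,x)$ be a smooth inelastic timelike curve flow, i.e. $\eta(\gamma_x,\gamma_x)=-1$, for $t$ and $x$ in open sets $T,X\subseteq\mathbb R$. Let $(e_0=\gamma_x,e_1,e_2)$ be a smooth oriented orthonormal frame along the flow which is a parallel frame of each curve, i.e. $(e_1)_x$ and $(e_2)_x$ are multiples of $e_0$. Define $u=u_1+iu_2$, $\omega=\omega_1+i\omega_2$, $h_\perp=h_1+ih_2$, $h_\parallel$ and $\omega_0$ by $$(e_0)_x=u_1e_1+u_2e_2,\quad (e_0)_t=\omega_1e_1+\omega_2e_2,\quad \gamma_t=h_\parallel e_0+h_1e_1+h_2e_2,\quad (e_1)_t=\omega_1e_0+\omega_0e_2 ;$$ $u$ is the Hasimoto variable of the curve. Let $\mathcal C$ be complex conjugation and $$\mathcal H=D_x+iuD_x^{-1}\mathrm{Im}(u\,\mathcal C),\quad \mathcal J=D_x-uD_x^{-1}\mathrm{Re}(u\,\mathcal C),\quad \mathcal I=-i,\quad \mathcal R=i\big(D_x-uD_x^{-1}\mathrm{Re}(u\,\mathcal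 C)\big).$$ Let $\mathcal S$ be the space of rapidly decreasing smooth functions $\mathbb R\to\mathbb C$, with the real pairing $\langle f,g\rangle=\int \mathrm{Re}(\bar f g)\,dx$. For $u\in\mathcal S$ the operators are real-linear maps $\mathcal S\to\mathcal S$ with $D_x^{-1}g(x)=\tfrac12\big(\int_{-\infty}^x g-\int_x^\infty g\big)$. *Definitions.* A functional is a function $\mathfrak F:\mathcal S\to\mathbb R$ with a variational derivative $\delta\mathfrak F/\delta\bar u=\overline{\delta\mathfrak F/\delta u}\in\mathcal S$, that is, $\frac{d}{ds}\big|_{0}\mathfrak F(u+sv)=2\,\mathrm{Re}\int(\delta\mathfrak F/\delta u)\,v\,dx$ for all $u,v\in\mathcal S$, which is a Fréchet differentiable function of $u$. An operator $\mathcal D$ (depending on $u$) is *Hamiltonian* if its bracket $\{\mathfrak F,\mathfrak G\}_{\mathcal D}=\int\mathrm{Re}\big((\delta\mathfrak F/\delta u)\,\mathcal D(\delta\mathfrak G/\delta\bar u)\big)dx$ is skew, if the bracket of two functionals again has a variational derivative in $\mathcal S$, and if the Jacobi identity holds. An operator $\mathcal K$ is *symplectic* if $\langle w_1,\mathcal K_u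 w_2\rangle$ is a closed, nondegenerate two-form on $\mathcal S$ (equivalently, $\mathcal K^{-1}$ is Hamiltonian on the range of $\mathcal K$). Two Hamiltonian operators are *compatible* if all their real linear combinations are Hamiltonian; a Hamiltonian operator $\mathcal D$ and a symplectic operator $\mathcal K$ are compatible if all $c_1\mathcal D+c_2\mathcal K^{-1}$, $c_1,c_2\in\mathbb R$, are Hamiltonian on the range of $\mathcal K$, i.e. $\{(\mathcal K_uw,\;c_1\mathcal D_u\mathcal K_uw+c_2w):w\in\mathcal S\}$ is isotropic and closed under the Courant bracket. Write $\mathcal R'[v]$ and $X'[v]$ for derivatives in the direction $v$. $\mathcal R$ is *hereditary* if $\mathcal R'[\mathcal Rf]g-\mathcal R'[\mathcal Rg]f=\mathcal R(\mathcal R'[f]g-\mathcal R'[g]f)$ for all $u,f,g\in\mathcal S$; it is a *recursion operator* of $u_t=X(u)$ if $\mathcal R'[X]g=X'[\mathcal Rg]-\mathcal RX'[g]$ for all $u,g\in\mathcal S$. An operator $\mathcal D$ is *$U(1)$-invariant* if $\mathcal D_{e^{i\phi}u}(e^{i\phi}f)=e^{i\phi}\mathcal D_u(f)$ for all real $\phi$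 and all $u,f\in\mathcal S$. **Theorem.** 1. For every such flow, with $D_x^{-1}$ denoting an $x$-antiderivative on $X$, $$u_t=D_x\omega-iuD_x^{-1}\mathrm{Im}(\omega\bar u)=\mathcal H(\omega),\qquad \omega=D_xh_\perp-uD_x^{-1}\mathrm{Re}(\bar u h_\perp)=\mathcal J(h_\perp),\qquad u_t=-\mathcal R^2(h_\perp).$$ If $X=\mathbb R$, $u(t,\cdot)$ and $h_\perp(t,\cdot)$ lie in $\mathcal S$, and $h_\parallel(t,x)+h_\parallel(t,-x)\to0$, $\omega_0(t,x)+\omega_0(t,-x)\to0$ as $x\to\infty$, for every $t\in T$, then $\omega(t,\cdot)\in\mathcal S$ and these equations hold with the operators on $\mathcal S$ defined above. 2. $\mathcal H$ is a Hamiltonian operator, $\mathcal J$ is a symplectic operator, they are compatible, and both are $U(1)$-invariant. 3. $\mathcal I$ is a Hamiltonian operator compatible with $\mathcal H$ and with $\mathcal J$, and $\mathcal H\mathcal I^{-1}=-\mathcal I\mathcal J$, $\mathcal J\mathcal I=-\mathcal I^{-1}\mathcal H$. 4. $\mathcal R=\mathcal H\mathcal I^{-1}=-\mathcal I\mathcal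 J$ is $U(1)$-invariant and hereditary, and it is a recursion operator of each of the flows $u_t=\mathcal R^n(-iu)$, $n=0,1,2,\dots$ -/

import Mathlib

open MeasureTheory Filter Topology Set
open scoped SchwartzMap ContDiff

noncomputable section

namespace HasimotoFlow

/-! ### Minkowski space, inelastic timelike flows, parallel frames -/

/-- Three-dimensional Minkowski space in inertial coordinates `(X⁰, X¹, X²)`. -/
abbrev Mink : Type := Fin 3 → ℝ

/-- The Minkowski metric of signature `(-1, 1, 1)`. -/
def eta (v w : Mink) : ℝ := -(v 0 * w 0) + v 1 * w 1 + v 2 * w 2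

/-- The volume form, normalised by `ε₀₁₂ = 1`. -/
def vol (v w z : Mink) : ℝ := Matrix.det (Matrix.of ![v, w, z])

/-- `∂_x` of a vector-valued function of `(t, x)`. -/
def dx (f : ℝ → ℝ → Mink) (t x : ℝ) : Mink := deriv (fun y => f t y) x

/-- `∂_t` of a vector-valued function of `(t, x)`. -/
def dt (f : ℝ → ℝ → Mink) (t x : ℝ) : Mink := deriv (fun s => f s x) t

/-- Smoothness of a function of `(t, x)` on `T × X`. -/
def SmoothOn (T X : Set ℝ) (f : ℝ → ℝ → Mink) : Prop :=
  ContDiffOn ℝ ∞ (fun p : ℝ × ℝ => f p.1 p.2) (T ×ˢ X)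

/-- A smooth flow of timelike curves `x ↦ γ(t, x)`, `x ∈ X`, with parameter `t ∈ T`, which is
inelastic: `x` is the proper time along every curve of the flow. -/
structure IsInelasticTimelikeFlow (T X : Set ℝ) (γ : ℝ → ℝ → Mink) : Prop where
  smooth : SmoothOn T X γ
  unit : ∀ t ∈ T, ∀ x ∈ X, eta (dx γ t x) (dx γ t x) = -1

/-- `(γ_x, e₁, e₂)` is a smooth, oriented, orthonormal frame along the flow, and it is a Lorentzian
parallel frame of every curve: the `x`-derivatives of `e₁` and `e₂` are parallel to `γ_x`. -/
structure IsParallelFrame (T X : Set ℝ) (γ e₁ e₂ : ℝ → ℝ → Mink) : Prop where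
  smooth₁ : SmoothOn T X e₁
  smooth₂ : SmoothOn T X e₂
  unit₁ : ∀ t ∈ T, ∀ x ∈ X, eta (e₁ t x) (e₁ t x) = 1
  unit₂ : ∀ t ∈ T, ∀ x ∈ X, eta (e₂ t x) (e₂ t x) = 1
  orth₀₁ : ∀ t ∈ T, ∀ x ∈ X, eta (dx γ t x) (e₁ t x) = 0
  orth₀₂ : ∀ t ∈ T, ∀ x ∈ X, eta (dx γ t x) (e₂ t x) = 0
  orth₁₂ : ∀ t ∈ T, ∀ x ∈ X, eta (e₁ t x) (e₂ t x) = 0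
  oriented : ∀ t ∈ T, ∀ x ∈ X, vol (dx γ t x) (e₁ t x) (e₂ t x) = 1
  parallel₁ : ∀ t ∈ T, ∀ x ∈ X, ∃ a : ℝ, dx e₁ t x = a • dx γ t x
  parallel₂ : ∀ t ∈ T, ∀ x ∈ X, ∃ a : ℝ, dx e₂ t x = a • dx γ t x

/-- The complex number `η(v, e₁) + i η(v, e₂)` formed from the normal components of `v`. -/
def perp (v a b : Mink) : ℂ := (eta v a : ℂ) + Complex.I * (eta v b : ℂ)

/-- The Hasimoto variable `u = u₁ + i u₂`, where `(e₀)_x = u₁ e₁ + u₂ e₂`, `e₀ = γ_x`. -/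
def uVar (γ e₁ e₂ : ℝ → ℝ → Mink) (t x : ℝ) : ℂ := perp (dx (dx γ) t x) (e₁ t x) (e₂ t x)

/-- `ω = ω₁ + i ω₂`, where `(e₀)_t = ω₁ e₁ + ω₂ e₂`, `e₀ = γ_x`. -/
def omegaVar (γ e₁ e₂ : ℝ → ℝ → Mink) (t x : ℝ) : ℂ := perp (dt (dx γ) t x) (e₁ t x) (e₂ t x)

/-- `h_⊥ = h₁ + i h₂`, where `γ_t = h_∥ e₀ + h₁ e₁ + h₂ e₂`. -/
def hPerp (γ e₁ e₂ : ℝ → ℝ → Mink) (t x : ℝ) : ℂ := perp (dt γ t x) (e₁ t x) (e₂ t x)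

/-- `h_∥`, where `γ_t = h_∥ e₀ + h₁ e₁ + h₂ e₂`. -/
def hPar (γ : ℝ → ℝ → Mink) (t x : ℝ) : ℝ := -eta (dt γ t x) (dx γ t x)

/-- `ω₀`, where `(e₁)_t = ω₁ e₀ + ω₀ e₂`. -/
def omegaZero (e₁ e₂ : ℝ → ℝ → Mink) (t x : ℝ) : ℝ := eta (dt e₁ t x) (e₂ t x)

/-! ### The operators for general smooth functions

Without conditions at the ends of the `x`-interval, `D_x⁻¹ g` stands for an antiderivative of `g`,
so that an expression with one `D_x⁻¹` has a set of values. -/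

/-- The antiderivatives of `g` on `X`. -/
def Antideriv (X : Set ℝ) (g : ℝ → ℝ) : Set (ℝ → ℝ) := {P | ∀ x ∈ X, HasDerivAt P (g x) x}

/-- The values on `X` of `D_x f + i u D_x⁻¹ Im(u f̄)`. -/
def valH (X : Set ℝ) (u f : ℝ → ℂ) : Set (ℝ → ℂ) :=
  {v | ∃ P ∈ Antideriv X (fun y => (u y * starRingEnd ℂ (f y)).im),
    ∀ x ∈ X, v x = deriv f x + Complex.I * u x * (P x : ℂ)}

/-- The values on `X` of `D_x f - u D_x⁻¹ Re(u f̄)`. -/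
def valJ (X : Set ℝ) (u f : ℝ → ℂ) : Set (ℝ → ℂ) :=
  {v | ∃ P ∈ Antideriv X (fun y => (u y * starRingEnd ℂ (f y)).re),
    ∀ x ∈ X, v x = deriv f x - u x * (P x : ℂ)}

/-- The values on `X` of `i (D_x f - u D_x⁻¹ Re(u f̄))`. -/
def valR (X : Set ℝ) (u f : ℝ → ℂ) : Set (ℝ → ℂ) :=
  {v | ∃ w ∈ valJ X u f, ∀ x ∈ X, v x = Complex.I * w x}

/-! ### The operators on rapidly decreasing functions -/

/-- The space of rapidly decreasing smooth functions `u : ℝ → ℂ`. -/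
abbrev Sch : Type := 𝓢(ℝ, ℂ)

/-- The skew-adjoint inverse of `D_x` on integrable functions,
`D_x⁻¹ g (x) = ½ (∫_{-∞}^x g - ∫_x^∞ g)`. -/
def dxInv (g : ℝ → ℝ) (x : ℝ) : ℝ := ((∫ y in Iic x, g y) - ∫ y in Ioi x, g y) / 2

theorem dxInv_eq (g : 𝓢(ℝ, ℝ)) (x : ℝ) :
    dxInv g x = (∫ y in Iic (0 : ℝ), g y) + (∫ y in (0 : ℝ)..x, g y) - (∫ y, g y) / 2 := by
  have hi : Integrable (g : ℝ → ℝ) := g.integrable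
  have h1 := intervalIntegral.integral_Iic_add_Ioi (b := x) hi.integrableOn hi.integrableOn
  have h2 := intervalIntegral.integral_Iic_sub_Iic (a := (0 : ℝ)) (b := x) hi.integrableOn
    hi.integrableOn
  unfold dxInv
  linarith

theorem hasDerivAt_dxInv (g : 𝓢(ℝ, ℝ)) (x : ℝ) : HasDerivAt (dxInv g) (g x) x := by
  have h : dxInv g = fun x =>
      (∫ y in Iic (0 : ℝ), g y) + (∫ y in (0 : ℝ)..x, g y) - (∫ y, g y) / 2 :=
    funext (dxInv_eq g)
  rw [h]
  have h3 : HasDerivAt (fun x => ∫ y in (0 : ℝ)..x, g y) (g x) x :=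
    intervalIntegral.integral_hasDerivAt_right (g.continuous.intervalIntegrable _ _)
      g.continuous.stronglyMeasurable.stronglyMeasurableAtFilter g.continuous.continuousAt
  exact (h3.const_add _).sub_const _

theorem abs_dxInv_le (g : 𝓢(ℝ, ℝ)) (x : ℝ) : |dxInv g x| ≤ ∫ y, |g y| := by
  have hi : Integrable (g : ℝ → ℝ) := g.integrable
  have h1 := intervalIntegral.integral_Iic_add_Ioi (b := x) hi.abs.integrableOn hi.abs.integrableOn
  have h2 : |∫ y in Iic x, g y| ≤ ∫ y in Iic x, |g y| := abs_integral_le_integral_abs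
  have h3 : |∫ y in Ioi x, g y| ≤ ∫ y in Ioi x, |g y| := abs_integral_le_integral_abs
  have h4 : 0 ≤ ∫ y, |g y| := integral_nonneg fun _ => abs_nonneg _
  unfold dxInv
  rw [abs_le] at *
  constructor <;> linarith [h2.1, h2.2, h3.1, h3.2]

theorem dxInv_hasTemperateGrowth (g : 𝓢(ℝ, ℝ)) : (dxInv g).HasTemperateGrowth := by
  have hd : Differentiable ℝ (dxInv g) := fun x => (hasDerivAt_dxInv g x).differentiableAt
  have hf : fderiv ℝ (dxInv g) =
      fun x => ContinuousLinearMap.toSpanSingletonCLE (𝕜 := ℝ) (E := ℝ) (g x) := by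
    funext x
    rw [(hasDerivAt_dxInv g x).hasFDerivAt.fderiv]
    rfl
  refine Function.HasTemperateGrowth.of_fderiv (k := 0) (C := ∫ y, |g y|) ?_ hd ?_
  · rw [hf]
    exact (ContinuousLinearMap.toSpanSingletonCLE (𝕜 := ℝ) (E := ℝ)).hasTemperateGrowth.comp
      g.hasTemperateGrowth
  · intro x
    simpa using abs_dxInv_le g x

theorem dxInv_add (g h : 𝓢(ℝ, ℝ)) : dxInv (g + h : 𝓢(ℝ, ℝ)) = dxInv g + dxInv h := by
  funext x
  have hg : Integrable (g : ℝ → ℝ) := g.integrable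
  have hh : Integrable (h : ℝ → ℝ) := h.integrable
  simp only [dxInv, Pi.add_apply, add_apply]
  rw [integral_add hg.integrableOn hh.integrableOn, integral_add hg.integrableOn hh.integrableOn]
  ring

theorem dxInv_smul (c : ℝ) (g : 𝓢(ℝ, ℝ)) : dxInv (c • g : 𝓢(ℝ, ℝ)) = c • dxInv g := by
  funext x
  simp only [dxInv, Pi.smul_apply, smul_apply, smul_eq_mul]
  rw [integral_const_mul, integral_const_mul]
  ring

/-- `g ↦ u D_x⁻¹ g`. -/
def mulDxInv (u : Sch) : 𝓢(ℝ, ℝ) →ₗ[ℝ] Sch where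
  toFun g := SchwartzMap.smulLeftCLM ℂ (dxInv g) u
  map_add' g h := by
    rw [dxInv_add, SchwartzMap.smulLeftCLM_add (dxInv_hasTemperateGrowth g)
      (dxInv_hasTemperateGrowth h)]
    rfl
  map_smul' c g := by
    rw [dxInv_smul, SchwartzMap.smulLeftCLM_smul (dxInv_hasTemperateGrowth g)]
    rfl

theorem mulDxInv_apply (u : Sch) (g : 𝓢(ℝ, ℝ)) (x : ℝ) :
    mulDxInv u g x = u x * (dxInv g x : ℂ) := by
  have h := SchwartzMap.smulLeftCLM_apply_apply (dxInv_hasTemperateGrowth g) u x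
  rw [Complex.real_smul, mul_comm] at h
  exact h

/-- `f ↦ u f̄`. -/
def mulConj (u : Sch) : Sch →ₗ[ℝ] Sch :=
  (SchwartzMap.pairing (ContinuousLinearMap.mul ℝ ℂ) u).toLinearMap ∘ₗ
    (SchwartzMap.postcompCLM (𝕜 := ℝ)
      (Complex.conjCLE : ℂ →L[ℝ] ℂ) : Sch →L[ℝ] Sch).toLinearMap

/-- `f ↦ Re(u f̄)`. -/
def reMulConj (u : Sch) : Sch →ₗ[ℝ] 𝓢(ℝ, ℝ) :=
  (SchwartzMap.postcompCLM (𝕜 := ℝ) Complex.reCLM : Sch →L[ℝ] 𝓢(ℝ, ℝ)).toLinearMap ∘ₗ mulConj u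

/-- `f ↦ Im(u f̄)`. -/
def imMulConj (u : Sch) : Sch →ₗ[ℝ] 𝓢(ℝ, ℝ) :=
  (SchwartzMap.postcompCLM (𝕜 := ℝ) Complex.imCLM : Sch →L[ℝ] 𝓢(ℝ, ℝ)).toLinearMap ∘ₗ mulConj u

/-- `D_x`. -/
def opD : Sch →ₗ[ℝ] Sch := (SchwartzMap.derivCLM ℝ ℂ).toLinearMap

/-- Multiplication by the complex number `c`. -/
def opMul (c : ℂ) : Sch →ₗ[ℝ] Sch := LinearMap.lsmul ℂ Sch c |>.restrictScalars ℝ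

/-- `ℋ = D_x + i u D_x⁻¹ Im(u 𝒞)`, an operator that depends on `u`. -/
def opH (u : Sch) : Sch →ₗ[ℝ] Sch := opD + opMul Complex.I ∘ₗ mulDxInv u ∘ₗ imMulConj u

/-- `𝒥 = D_x - u D_x⁻¹ Re(u 𝒞)`. -/
def opJ (u : Sch) : Sch →ₗ[ℝ] Sch := opD - mulDxInv u ∘ₗ reMulConj u

/-- `ℛ = i (D_x - u D_x⁻¹ Re(u 𝒞))`. -/
def opR (u : Sch) : Sch →ₗ[ℝ] Sch := opMul Complex.I ∘ₗ (opD - mulDxInv u ∘ₗ reMulConj u)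

/-- `ℐ = -i`, which is invertible and does not depend on `u`. -/
def opI : Sch ≃ₗ[ℝ] Sch :=
  (LinearEquiv.smulOfNeZero ℂ Sch (-Complex.I) (neg_ne_zero.2 Complex.I_ne_zero)).restrictScalars ℝ

theorem opH_apply (u f : Sch) (x : ℝ) :
    opH u f x = deriv f x
      + Complex.I * u x * (dxInv (fun y => (u y * starRingEnd ℂ (f y)).im) x : ℂ) := by
  have h := mulDxInv_apply u (imMulConj u f) x
  have h' : opH u f x = deriv f x + Complex.I * mulDxInv u (imMulConj u f) x := rfl
  rw [h', h, mul_assoc]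
  rfl

theorem opJ_apply (u f : Sch) (x : ℝ) :
    opJ u f x = deriv f x
      - u x * (dxInv (fun y => (u y * starRingEnd ℂ (f y)).re) x : ℂ) := by
  have h := mulDxInv_apply u (reMulConj u f) x
  have h' : opJ u f x = deriv f x - mulDxInv u (reMulConj u f) x := rfl
  rw [h', h]
  rfl

theorem opR_apply (u f : Sch) (x : ℝ) :
    opR u f x = Complex.I * (deriv f x
      - u x * (dxInv (fun y => (u y * starRingEnd ℂ (f y)).re) x : ℂ)) := by
  rw [← opJ_apply]
  rfl

theorem opI_apply (f : Sch) (x : ℝ) : opI f x = -Complex.I * f x := rfl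

/-! ### Poisson brackets, Hamiltonian and symplectic operators

The operators act at a point `u` of the phase space `Sch`; tangent vectors and variational
derivatives are elements of `Sch`, paired by `∫ Re(f̄ g) dx`. -/

/-- An operator depending on `u`. -/
abbrev Op : Type := Sch → Sch →ₗ[ℝ] Sch

/-- `∫ Re(f̄ g) dx`. -/
def pair (f g : Sch) : ℝ := ∫ x, (starRingEnd ℂ (f x) * g x).re

/-- `g = δF/δū`, that is, `dF(u)[v] = ∫ (δF/δu v + δF/δū v̄) dx = 2 ∫ Re(ḡ v) dx`; the functional
`F` is real, so that `δF/δu` is the complex conjugate of `δF/δū`. -/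
def IsVarDeriv (F : Sch → ℝ) (g : Sch → Sch) : Prop :=
  ∀ u v : Sch, HasDerivAt (fun s : ℝ => F (u + s • v)) (2 * pair (g u) v) 0

/-- Real functionals with a variational derivative `δF/δū` which is a Fréchet differentiable
function of `u` for the topology of `Sch`. -/
structure Functional where
  toFun : Sch → ℝ
  grad : Sch → Sch
  isVarDeriv : IsVarDeriv toFun grad
  differentiable : Differentiable ℝ grad

/-- The bracket `∫ Re((δF/δu) 𝒟(δG/δū)) dx`, in terms of `a = δF/δū` and `b = δG/δū`. -/
def bracket (D : Op) (a b : Sch → Sch) (u : Sch) : ℝ := pair (a u) (D u (b u))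

/-- `𝒟` is Hamiltonian: its bracket is skew, the bracket of two functionals has again a variational
derivative, and the Jacobi identity holds. -/
def IsHamiltonian (D : Op) : Prop :=
  (∀ (F G : Functional) (u : Sch),
    bracket D F.grad G.grad u + bracket D G.grad F.grad u = 0) ∧
  ∀ F G L : Functional, ∃ a b c : Sch → Sch,
    IsVarDeriv (bracket D F.grad G.grad) a ∧
    IsVarDeriv (bracket D G.grad L.grad) b ∧
    IsVarDeriv (bracket D L.grad F.grad) c ∧
    ∀ u : Sch, bracket D a L.grad u + bracket D b F.grad u + bracket D c G.grad u = 0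

/-- The operator `A B⁻¹` is Hamiltonian. Here `B_u` is injective, and `A_u B_u⁻¹` is defined on the
range of `B_u`, which may be smaller than the phase space. For covectors `f_k = B_u w_k` the skew
symmetry is `⟨f₁, A B⁻¹ f₂⟩ + ⟨f₂, A B⁻¹ f₁⟩ = 0`. The Jacobi identity is the vanishing of the cyclic
sum of `⟨f₁, (A B⁻¹)'[A B⁻¹ f₂] f₃⟩`, where `'[v]` is the derivative in the direction `v`, or of
`⟨B w₁, A'[A w₂] w₃⟩ + ⟨A w₁, B'[A w₂] w₃⟩`, by
`(A B⁻¹)'[v] = A'[v] B⁻¹ - A B⁻¹ B'[v] B⁻¹` and the skew symmetry. In other words, the subspaces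
`{(B_u w, A_u w)}` are isotropic and closed under the Courant bracket. -/
def IsHamiltonianFraction (A B : Op) : Prop :=
  (∀ u : Sch, Function.Injective (B u)) ∧
  (∀ u w₁ w₂ : Sch, pair (B u w₁) (A u w₂) + pair (B u w₂) (A u w₁) = 0) ∧
  ∃ d : Sch → Sch → Sch → Sch → ℝ,
    (∀ u w₁ w₂ w₃ : Sch, HasDerivAt
      (fun s : ℝ => pair (B u w₁) (A (u + s • A u w₂) w₃) + pair (A u w₁) (B (u + s • A u w₂) w₃))
      (d u w₁ w₂ w₃) 0) ∧
    ∀ u w₁ w₂ w₃ : Sch, d u w₁ w₂ w₃ + d u w₂ w₃ w₁ + d u w₃ w₁ w₂ = 0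

/-- `J` is symplectic: the two-form `⟨w₁, J_u w₂⟩` is nondegenerate, skew and closed. Equivalently,
the inverse of `J` exists on the range of `J` and is Hamiltonian. -/
def IsSymplectic (J : Op) : Prop :=
  (∀ u : Sch, Function.Injective (J u)) ∧
  (∀ u w₁ w₂ : Sch, pair w₁ (J u w₂) + pair w₂ (J u w₁) = 0) ∧
  ∃ d : Sch → Sch → Sch → Sch → ℝ,
    (∀ u w₁ w₂ w₃ : Sch,
      HasDerivAt (fun s : ℝ => pair w₁ (J (u + s • w₂) w₃)) (d u w₁ w₂ w₃) 0) ∧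
    ∀ u w₁ w₂ w₃ : Sch, d u w₁ w₂ w₃ + d u w₂ w₃ w₁ + d u w₃ w₁ w₂ = 0

/-- Compatibility of two Hamiltonian operators: all `c₁ D₁ + c₂ D₂` are Hamiltonian. -/
def Compatible (D₁ D₂ : Op) : Prop :=
  ∀ c₁ c₂ : ℝ, IsHamiltonian (fun u => c₁ • D₁ u + c₂ • D₂ u)

/-- Compatibility of a Hamiltonian operator `D` and a symplectic operator `J`: all
`c₁ D + c₂ J⁻¹ = (c₁ D J + c₂) J⁻¹` are Hamiltonian. -/
def CompatibleSymplectic (D J : Op) : Prop :=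
  ∀ c₁ c₂ : ℝ, IsHamiltonianFraction (fun u => c₁ • (D u ∘ₗ J u) + c₂ • LinearMap.id) J

/-! ### Recursion operators -/

/-- `R` is hereditary: `R'[R f] g - R'[R g] f = R (R'[f] g - R'[g] f)`, where `R'[v]` is the
derivative of `R` in the direction `v`. -/
def IsHereditary (R : Op) : Prop :=
  ∃ dR : Sch → Sch → Sch → Sch,
    (∀ u v g : Sch, HasDerivAt (fun s : ℝ => R (u + s • v) g) (dR u v g) 0) ∧
    ∀ u f g : Sch, dR u (R u f) g - dR u (R u g) f = R u (dR u f g - dR u g f)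

/-- `R` is a recursion operator of the evolution equation `u_t = X(u)`: it commutes with the
linearised equation, `R'[X] g = X'[R g] - R X'[g]`. -/
def IsRecursionOperator (R : Op) (X : Sch → Sch) : Prop :=
  ∃ (dR : Sch → Sch → Sch → Sch) (dX : Sch → Sch → Sch),
    (∀ u v g : Sch, HasDerivAt (fun s : ℝ => R (u + s • v) g) (dR u v g) 0) ∧
    (∀ u g : Sch, HasDerivAt (fun s : ℝ => X (u + s • g)) (dX u g) 0) ∧
    ∀ u g : Sch, dR u (X u) g = dX u (R u g) - R u (dX u g)

/-- Equivariance of an operator under the phase rotations `u ↦ e^{iφ} u`. -/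
def IsU1Invariant (D : Op) : Prop :=
  ∀ (φ : ℝ) (u f : Sch),
    D (Complex.exp (φ * Complex.I) • u) (Complex.exp (φ * Complex.I) • f)
      = Complex.exp (φ * Complex.I) • D u f

end HasimotoFlow

end

noncomputable section

namespace HasimotoFlow

/-! ### Derivatives of maps between topological vector spaces -/

section TVS

open Asymptotics

variable {E F G : Type*} [AddCommGroup E] [Module ℝ E] [TopologicalSpace E]
  [AddCommGroup F] [Module ℝ F] [TopologicalSpace F]
  [AddCommGroup G] [Module ℝ G] [TopologicalSpace G]

/-! The flow equations are the structure equations of the parallel frame. Commuting `∂_t` and `∂_x`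
and using orthonormality gives `u_t = ω_x - i ω₀ u`, `(ω₀)_x = -Im(u ω̄)`, `ω = (h_⊥)_x + h_∥ u` and
`(h_∥)_x = -Re(u h̄_⊥)`; so `-ω₀` and `-h_∥` are the antiderivatives in `ℋ` and `𝒥`. On the whole
line the conditions at infinity make them the values of the skew-adjoint `D_x⁻¹`
(`eq_dxInv_of_hasDerivAt`).

Since `Re(iu f̄) = -Im(u f̄)`, both `ℋ` and `𝒥` have the form `D_x - (Lu) D_x⁻¹ Re((Lu) 𝒞)`, with `L
= i` and `L = 1` (`quadOp`). Such an operator is skew and quadratic in `u`, and its variation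
satisfies `⟨f, 𝒟'[v] g⟩ = ⟨L v, m(f, g)⟩` with `m` explicit (`pair_quadOpDeriv`). For functionals,
symmetry of the second variation (`IsVarDeriv.hessian_symm`) removes the Hessians from the Jacobi
identity; what remains is a cyclic sum of `⟨f₁, 𝒟'[𝒟 f₂] f₃⟩` (`isHamiltonian_of_cyclic`).

All Hamiltonian, symplectic and compatibility statements then reduce to four cyclic identities,
`cyclic_quadOpForm`, `cyclic_quadOpForm_opH`, `cyclic_quadOpForm_opI` and
`cyclic_quadOpForm_opH_opJ`: in each the integrand is the derivative of an explicit rapidly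
decreasing function. A real linear combination of operators gives a polynomial in the coefficients,
with these identities as its coefficients. Nondegeneracy of `𝒥` is a separate ODE argument
(`opJ_injective`).

For `ℛ`, the hereditary identity is a direct computation that needs `D_x⁻¹ D_x = 1` once
(`opR_hereditary`). Phase invariance makes `ℛ` a recursion operator of `u_t = -iu`, and heredity
carries this from `X` to `ℛX`. -/

theorem hasFDerivAt_iff_isLittleOTVS_sub {f : E → F} {f' : E →L[ℝ] F} {x : E} :
    HasFDerivAt f f' x ↔ (fun y => f y - f x - f' (y - x)) =o[ℝ; 𝓝 x] fun y => y - x := by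
  rw [HasFDerivAt, hasFDerivAtFilter_iff_isLittleOTVS, prod_pure, isLittleOTVS_map]
  rfl

/-- The chain rule in topological vector spaces. -/
theorem hasFDerivAt_comp_tvs [ContinuousAdd E] [ContinuousSMul ℝ E] [ContinuousAdd F]
    [ContinuousSMul ℝ F] [ContinuousAdd G] [ContinuousSMul ℝ G] {f : E → F} {g : F → G}
    {f' : E →L[ℝ] F} {g' : F →L[ℝ] G} {x : E}
    (hg : HasFDerivAt g g' (f x)) (hf : HasFDerivAt f f' x) :
    HasFDerivAt (fun y => g (f y)) (g'.comp f') x := by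
  rw [hasFDerivAt_iff_isLittleOTVS_sub]
  have h1 : (fun y => g (f y) - g (f x) - g' (f y - f x)) =o[ℝ; 𝓝 x] fun y => y - x :=
    IsLittleOTVS.trans_isBigOTVS (IsLittleOTVS.comp_tendsto
      (hasFDerivAt_iff_isLittleOTVS_sub.1 hg) (HasFDerivAt.continuousAt hf).tendsto)
      hf.isBigOTVS_sub
  have h2 : (fun y => g' (f y - f x - f' (y - x))) =o[ℝ; 𝓝 x] fun y => y - x :=
    (g'.isBigOTVS_fun_comp).trans_isLittleOTVS (hasFDerivAt_iff_isLittleOTVS_sub.1 hf)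
  refine (h1.add h2).congr_left fun y => ?_
  simp only [Pi.add_apply, map_sub, ContinuousLinearMap.comp_apply]
  abel

/-- The Schwartz space carries no norm, so derivatives of curves are handled as limits of difference
quotients; sum and product rules then reduce to continuity. -/
theorem hasDerivAt_zero_iff [IsTopologicalAddGroup E] [ContinuousSMul ℝ E] {c : ℝ → E} {c' : E} :
    HasDerivAt c c' 0 ↔ Tendsto (fun s : ℝ => s⁻¹ • (c s - c 0)) (𝓝[≠] 0) (𝓝 c') := by
  have h0 : HasDerivAt c c' 0 ↔
      (fun s : ℝ => c s - c 0 - s • c') =o[ℝ; 𝓝 0] fun s : ℝ => s := by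
    rw [hasDerivAt_iff_hasFDerivAt, hasFDerivAt_iff_isLittleOTVS_sub]
    simp
  -- At `s = 0` the remainder vanishes, so the little-o condition need only be tested on the
  -- punctured neighbourhood, where division by `s` is possible.
  have h1 : 𝓝 (0 : ℝ) = 𝓝[insert 0 {0}ᶜ] 0 := by
    rw [Set.insert_eq, Set.union_compl_self, nhdsWithin_univ]
  rw [h0, h1, isLittleOTVS_insert (by simp),
    isLittleOTVS_iff_tendsto_inv_smul (by
      filter_upwards [self_mem_nhdsWithin] with s hs h using absurd h hs)]
  have h2 : (fun s : ℝ => s⁻¹ • (c s - c 0 - s • c')) =ᶠ[𝓝[≠] 0]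
      fun s => s⁻¹ • (c s - c 0) - c' := by
    filter_upwards [self_mem_nhdsWithin] with s hs
    rw [smul_sub, inv_smul_smul₀ hs]
  rw [tendsto_congr' h2, tendsto_sub_nhds_zero_iff]

theorem hasDerivAt_comp_tvs [ContinuousAdd E] [ContinuousSMul ℝ E] [ContinuousAdd F]
    [ContinuousSMul ℝ F] {c : ℝ → E} {c' : E} {g : E → F} {g' : E →L[ℝ] F} {t : ℝ}
    (hg : HasFDerivAt g g' (c t)) (hc : HasDerivAt c c' t) :
    HasDerivAt (fun s => g (c s)) (g' c') t := by
  have := hasFDerivAt_comp_tvs hg hc.hasFDerivAt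
  rw [hasDerivAt_iff_hasFDerivAt]
  convert this using 1
  ext
  simp

theorem HasDerivAt.continuousAt_tvs [ContinuousAdd E] [ContinuousSMul ℝ E] {c : ℝ → E} {c' : E}
    {t : ℝ} (hc : HasDerivAt c c' t) : ContinuousAt c t :=
  HasFDerivAt.continuousAt hc.hasFDerivAt

/-- Differentiation of a curve `L₀ c + s L₁ c + s² L₂ c` at `s = 0`. -/
theorem hasDerivAt_quadratic [IsTopologicalAddGroup E] [ContinuousSMul ℝ E]
    [IsTopologicalAddGroup F] [ContinuousSMul ℝ F] {c : ℝ → E} {c' : E}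
    {L₀ L₁ L₂ : E →ₗ[ℝ] F} (h₀ : Continuous L₀) (h₁ : Continuous L₁) (h₂ : Continuous L₂)
    (hc : HasDerivAt c c' 0) :
    HasDerivAt (fun s : ℝ => L₀ (c s) + s • L₁ (c s) + s ^ 2 • L₂ (c s)) (L₀ c' + L₁ (c 0)) 0 := by
  have hcont : Tendsto c (𝓝[≠] 0) (𝓝 (c 0)) :=
    (HasDerivAt.continuousAt_tvs hc).tendsto.mono_left nhdsWithin_le_nhds
  have hs : Tendsto (fun s : ℝ => s) (𝓝[≠] 0) (𝓝 0) := tendsto_id.mono_left nhdsWithin_le_nhds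
  rw [hasDerivAt_zero_iff] at hc ⊢
  have h := (((h₀.tendsto _).comp hc).add ((h₁.tendsto _).comp hcont)).add
    (hs.smul ((h₂.tendsto _).comp hcont))
  rw [zero_smul, add_zero] at h
  refine h.congr' ?_
  filter_upwards [self_mem_nhdsWithin] with s hs
  have hs' : s ≠ 0 := hs
  simp only [Function.comp_apply, zero_smul, ne_eq, OfNat.ofNat_ne_zero, not_false_eq_true,
    zero_pow, add_zero, map_smul, map_sub]
  rw [show L₀ (c s) + s • L₁ (c s) + s ^ 2 • L₂ (c s) - L₀ (c 0) =
    (L₀ (c s) - L₀ (c 0)) + (s • L₁ (c s) + s • s • L₂ (c s)) by rw [smul_smul, ← sq]; abel]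
  rw [smul_add, smul_add, inv_smul_smul₀ hs', inv_smul_smul₀ hs', add_assoc]

theorem hasDerivAt_clm_comp_tvs [IsTopologicalAddGroup E] [ContinuousSMul ℝ E]
    [IsTopologicalAddGroup F] [ContinuousSMul ℝ F] {c : ℝ → E} {c' : E} {L : E →ₗ[ℝ] F}
    (hL : Continuous L) (hc : HasDerivAt c c' 0) : HasDerivAt (fun s => L (c s)) (L c') 0 := by
  rw [hasDerivAt_zero_iff] at hc ⊢
  simpa [Function.comp_def] using ((hL.tendsto _).comp hc)

theorem hasDerivAt_add_tvs [IsTopologicalAddGroup E] [ContinuousSMul ℝ E] {c d : ℝ → E} {c' d' : E}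
    (hc : HasDerivAt c c' 0) (hd : HasDerivAt d d' 0) :
    HasDerivAt (fun s => c s + d s) (c' + d') 0 := by
  rw [hasDerivAt_zero_iff] at hc hd ⊢
  refine (hc.add hd).congr fun s => ?_
  rw [← smul_add]
  congr 1
  abel

theorem hasDerivAt_line [IsTopologicalAddGroup E] [ContinuousSMul ℝ E] (u v : E) :
    HasDerivAt (fun s : ℝ => u + s • v) v 0 := by
  rw [hasDerivAt_zero_iff]
  refine tendsto_const_nhds.congr' ?_
  filter_upwards [self_mem_nhdsWithin] with s hs
  simp [inv_smul_smul₀ (show s ≠ 0 from hs)]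

end TVS

/-! ### The antiderivative operator on rapidly decreasing functions -/

theorem tendsto_atTop_schwartz {F : Type*} [NormedAddCommGroup F] [NormedSpace ℝ F] (f : 𝓢(ℝ, F)) :
    Tendsto f atTop (𝓝 0) :=
  f.tendsto_cocompact.mono_left atTop_le_cocompact

theorem tendsto_atBot_schwartz {F : Type*} [NormedAddCommGroup F] [NormedSpace ℝ F] (f : 𝓢(ℝ, F)) :
    Tendsto f atBot (𝓝 0) :=
  f.tendsto_cocompact.mono_left atBot_le_cocompact

theorem integral_deriv_re_eq_zero (S : Sch) : ∫ x, (deriv S x).re = 0 := by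
  have h : Integrable fun x => (deriv S x).re := (SchwartzMap.derivCLM ℝ ℂ S).integrable.re
  have hd : ∀ x, HasDerivAt (fun y => (S y).re) (deriv S x).re x := fun x =>
    Complex.reCLM.hasFDerivAt.comp_hasDerivAt x (S.hasDerivAt x)
  have hl : ∀ l : Filter ℝ, Tendsto S l (𝓝 0) → Tendsto (fun y => (S y).re) l (𝓝 0) :=
    fun l hl => by simpa [Function.comp_def] using (Complex.continuous_re.tendsto 0).comp hl
  simpa using integral_of_hasDerivAt_of_tendsto hd h (hl _ (tendsto_atBot_schwartz S))
    (hl _ (tendsto_atTop_schwartz S))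

theorem tendsto_dxInv_atBot (g : 𝓢(ℝ, ℝ)) :
    Tendsto (dxInv g) atBot (𝓝 (-((∫ y, g y) / 2))) := by
  have hi : Integrable (g : ℝ → ℝ) := g.integrable
  have h : dxInv g = fun x => (∫ y in Iic x, g y) - (∫ y, g y) / 2 := by
    funext x
    have h1 := intervalIntegral.integral_Iic_add_Ioi (b := x) hi.integrableOn hi.integrableOn
    unfold dxInv
    linarith
  rw [h]
  simpa using (tendsto_integral_Iic_zero (f := g) (μ := volume) (tendsto_id (α := ℝ))).sub_const
    ((∫ y, g y) / 2)

theorem tendsto_dxInv_atTop (g : 𝓢(ℝ, ℝ)) :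
    Tendsto (dxInv g) atTop (𝓝 ((∫ y, g y) / 2)) := by
  have hi : Integrable (g : ℝ → ℝ) := g.integrable
  have h : dxInv g = fun x => (∫ y, g y) / 2 - ∫ y in Ioi x, g y := by
    funext x
    have h1 := intervalIntegral.integral_Iic_add_Ioi (b := x) hi.integrableOn hi.integrableOn
    unfold dxInv
    linarith
  rw [h]
  simpa using (tendsto_integral_Ioi_zero (f := g) (μ := volume) (tendsto_id (α := ℝ))).const_sub
    ((∫ y, g y) / 2)

/-- `D_x⁻¹ g` is the antiderivative of `g` that is odd at infinity. -/
theorem eq_dxInv_of_hasDerivAt {g : 𝓢(ℝ, ℝ)} {Q : ℝ → ℝ} (hQ : ∀ x, HasDerivAt Q (g x) x)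
    (h : Tendsto (fun x => Q x + Q (-x)) atTop (𝓝 0)) : Q = dxInv g := by
  have hd : ∀ x, HasDerivAt (fun y => Q y - dxInv g y) 0 x := fun x => by
    simpa using (hQ x).fun_sub (hasDerivAt_dxInv g x)
  have hc : ∀ x y, Q x - dxInv g x = Q y - dxInv g y :=
    is_const_of_deriv_eq_zero (fun x => (hd x).differentiableAt) fun x => (hd x).deriv
  -- `dxInv g` tends to `±½ ∫ g` at the two ends, so it is odd at infinity too; the constant
  -- difference must therefore vanish.
  have h1 : Tendsto (fun x => (Q x + Q (-x)) - (dxInv g x + dxInv g (-x))) atTop (𝓝 0) := by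
    simpa using h.sub ((tendsto_dxInv_atTop g).add
      ((tendsto_dxInv_atBot g).comp tendsto_neg_atTop_atBot))
  have h2 : (fun x => (Q x + Q (-x)) - (dxInv g x + dxInv g (-x))) =
      fun _ => 2 * (Q 0 - dxInv g 0) := by
    funext x
    linarith [hc x 0, hc (-x) 0]
  rw [h2, tendsto_const_nhds_iff] at h1
  funext x
  linarith [hc x 0]

theorem integrable_mul_dxInv (a b : 𝓢(ℝ, ℝ)) : Integrable fun x => a x * dxInv b x := by
  have h := (SchwartzMap.smulLeftCLM ℝ (dxInv b) a).integrable (μ := volume)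
  refine h.congr (.of_forall fun x => ?_)
  rw [SchwartzMap.smulLeftCLM_apply_apply (dxInv_hasTemperateGrowth b), smul_eq_mul, mul_comm]

/-- `D_x⁻¹` is skew-adjoint. -/
theorem integral_mul_dxInv_skew (a b : 𝓢(ℝ, ℝ)) :
    ∫ x, a x * dxInv b x = -∫ x, b x * dxInv a x := by
  -- The product of the two antiderivatives tends to `¼ (∫ a)(∫ b)` at both ends, so its derivative
  -- integrates to zero.
  have h := integral_of_hasDerivAt_of_tendsto
    (fun x => (hasDerivAt_dxInv a x).mul (hasDerivAt_dxInv b x))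
    ((integrable_mul_dxInv a b).add ((integrable_mul_dxInv b a).congr
      (.of_forall fun x => mul_comm _ _)))
    ((tendsto_dxInv_atBot a).mul (tendsto_dxInv_atBot b))
    ((tendsto_dxInv_atTop a).mul (tendsto_dxInv_atTop b))
  rw [neg_mul_neg, sub_self, integral_add (integrable_mul_dxInv a b)
    ((integrable_mul_dxInv b a).congr (.of_forall fun x => mul_comm _ _))] at h
  simp_rw [mul_comm (dxInv a _) (b _)] at h
  linarith

theorem hasDerivAt_ofReal_dxInv (g : 𝓢(ℝ, ℝ)) (x : ℝ) :
    HasDerivAt (fun y => (dxInv g y : ℂ)) (g x : ℂ) x :=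
  (hasDerivAt_dxInv g x).ofReal_comp

theorem deriv_mulDxInv (u : Sch) (g : 𝓢(ℝ, ℝ)) (x : ℝ) :
    deriv (mulDxInv u g) x = deriv u x * (dxInv g x : ℂ) + u x * (g x : ℂ) := by
  have h : (mulDxInv u g : ℝ → ℂ) = fun y => u y * (dxInv g y : ℂ) :=
    funext fun y => mulDxInv_apply u g y
  rw [h]
  exact ((u.hasDerivAt x).mul (hasDerivAt_ofReal_dxInv g x)).deriv

theorem mulDxInv_add_left (u v : Sch) (g : 𝓢(ℝ, ℝ)) :
    mulDxInv (u + v) g = mulDxInv u g + mulDxInv v g := by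
  ext x
  simp [mulDxInv_apply, add_mul]

theorem mulDxInv_smul_left (c : ℝ) (u : Sch) (g : 𝓢(ℝ, ℝ)) :
    mulDxInv (c • u) g = c • mulDxInv u g := by
  ext x
  simp [mulDxInv_apply, mul_assoc]

theorem seminorm_derivCLM (k n : ℕ) (f : Sch) :
    SchwartzMap.seminorm ℝ k (n + 1) f =
      SchwartzMap.seminorm ℝ k n (SchwartzMap.derivCLM ℝ ℂ f) := by
  have h : ∀ x : ℝ, iteratedDeriv (n + 1) f x =
      iteratedDeriv n (SchwartzMap.derivCLM ℝ ℂ f) x := fun x => by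
    rw [iteratedDeriv_succ']
    rfl
  refine le_antisymm (SchwartzMap.seminorm_le_bound' ℝ k (n + 1) f (apply_nonneg _ _) fun x => ?_)
    (SchwartzMap.seminorm_le_bound' ℝ k n _ (apply_nonneg _ _) fun x => ?_)
  · rw [h]
    exact SchwartzMap.le_seminorm' ℝ k n (SchwartzMap.derivCLM ℝ ℂ f) x
  · rw [← h]
    exact SchwartzMap.le_seminorm' ℝ k (n + 1) f x

theorem continuous_integral_abs : Continuous fun g : 𝓢(ℝ, ℝ) => ∫ y, |g y| := by
  have h : Continuous fun g : 𝓢(ℝ, ℝ) => ‖g.toLp 1 volume‖ :=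
    continuous_norm.comp SchwartzMap.continuous_toLp
  refine h.congr fun g => ?_
  rw [SchwartzMap.norm_toLp_one]
  simp [Real.norm_eq_abs]

/-- Induction on the number of derivatives, with `u` varying: `(u D_x⁻¹ g)' = u' D_x⁻¹ g + u g`, and
the undifferentiated antiderivative is bounded by the `L¹` norm of `g`. A bound that is continuous
and zero at `0` suffices for continuity. -/
theorem seminorm_mulDxInv_le (k n : ℕ) : ∀ u : Sch, ∃ q : 𝓢(ℝ, ℝ) → ℝ, Continuous q ∧ q 0 = 0 ∧
    ∀ g, SchwartzMap.seminorm ℝ k n (mulDxInv u g) ≤ q g := by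
  induction n with
  | zero =>
    intro u
    refine ⟨fun g => SchwartzMap.seminorm ℝ k 0 u * ∫ y, |g y|,
      continuous_const.mul continuous_integral_abs, by simp, fun g => ?_⟩
    have h0 : 0 ≤ ∫ y, |g y| := integral_nonneg fun _ => abs_nonneg _
    refine SchwartzMap.seminorm_le_bound' ℝ k 0 _ (by positivity) fun x => ?_
    have h1 := SchwartzMap.le_seminorm' ℝ k 0 u x
    rw [iteratedDeriv_zero] at h1 ⊢
    rw [mulDxInv_apply, norm_mul, Complex.norm_real, Real.norm_eq_abs (dxInv _ _), ← mul_assoc]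
    exact mul_le_mul h1 (abs_dxInv_le g x) (abs_nonneg _) (by positivity)
  | succ n ih =>
    intro u
    obtain ⟨q, hq, hq0, hle⟩ := ih (SchwartzMap.derivCLM ℝ ℂ u)
    let M : 𝓢(ℝ, ℝ) →L[ℝ] Sch := (SchwartzMap.pairing (ContinuousLinearMap.mul ℝ ℂ) u) ∘L
      (SchwartzMap.postcompCLM (𝕜 := ℝ) Complex.ofRealCLM)
    refine ⟨fun g => q g + SchwartzMap.seminorm ℝ k n (M g), hq.add
      (((schwartz_withSeminorms ℝ ℝ ℂ).continuous_seminorm (k, n)).comp M.continuous), by simp [hq0],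
      fun g => ?_⟩
    have h : SchwartzMap.derivCLM ℝ ℂ (mulDxInv u g) =
        mulDxInv (SchwartzMap.derivCLM ℝ ℂ u) g + M g := by
      ext x
      rw [SchwartzMap.derivCLM_apply, deriv_mulDxInv, add_apply, mulDxInv_apply]
      rfl
    rw [seminorm_derivCLM, h]
    exact (map_add_le_add _ _ _).trans (add_le_add (hle g) le_rfl)

theorem continuous_mulDxInv (u : Sch) : Continuous (mulDxInv u) := by
  refine (WithSeminorms.continuous_iff_continuous_comp (schwartz_withSeminorms ℝ ℝ ℂ) _).2 ?_
  rintro ⟨k, n⟩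
  obtain ⟨q, hq, hq0, hle⟩ := seminorm_mulDxInv_le k n u
  refine Seminorm.continuous_of_continuousAt_zero ?_
  rw [ContinuousAt, map_zero]
  have h : Tendsto q (𝓝 0) (𝓝 0) := by simpa [hq0] using hq.tendsto 0
  exact squeeze_zero (fun _ => apply_nonneg _ _) hle h

theorem continuous_reMulConj (u : Sch) : Continuous (reMulConj u) :=
  (SchwartzMap.postcompCLM (𝕜 := ℝ) Complex.reCLM : Sch →L[ℝ] 𝓢(ℝ, ℝ)).continuous.comp
    (((SchwartzMap.pairing (ContinuousLinearMap.mul ℝ ℂ) u).continuous).comp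
      (SchwartzMap.postcompCLM (𝕜 := ℝ) (Complex.conjCLE : ℂ →L[ℝ] ℂ) : Sch →L[ℝ] Sch).continuous)

theorem reMulConj_apply (u f : Sch) (x : ℝ) :
    reMulConj u f x = (u x).re * (f x).re + (u x).im * (f x).im := by
  have h : reMulConj u f x = (u x * starRingEnd ℂ (f x)).re := rfl
  simp [h]

theorem mulConj_apply (u f : Sch) (x : ℝ) : mulConj u f x = u x * starRingEnd ℂ (f x) := rfl

theorem opD_apply (f : Sch) (x : ℝ) : opD f x = deriv f x := rfl

theorem opMul_apply (c : ℂ) (f : Sch) (x : ℝ) : opMul c f x = c * f x := rfl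

theorem continuous_opD : Continuous opD := (SchwartzMap.derivCLM ℝ ℂ).continuous

theorem continuous_opMul (c : ℂ) : Continuous (opMul c) := continuous_const_smul c

/-- `D_x⁻¹ D_x = 1`. -/
theorem dxInv_eq_of_deriv {a b : 𝓢(ℝ, ℝ)} (h : ∀ x, HasDerivAt a (b x) x) : dxInv b = a := by
  refine (eq_dxInv_of_hasDerivAt h ?_).symm
  simpa using (tendsto_atTop_schwartz a).add
    ((tendsto_atBot_schwartz a).comp tendsto_neg_atTop_atBot)

/-! ### The pairing -/

theorem pair_eq_integral (f g : Sch) : pair f g = ∫ x, reMulConj f g x := by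
  refine integral_congr_ae (.of_forall fun x => ?_)
  simp [reMulConj_apply]

theorem pair_comm (f g : Sch) : pair f g = pair g f := by
  refine integral_congr_ae (.of_forall fun x => ?_)
  simp only [Complex.mul_re, Complex.conj_re, Complex.conj_im]
  ring

/-- The pairing with `f` as a linear form. -/
def pairLM (f : Sch) : Sch →ₗ[ℝ] ℝ :=
  (SchwartzMap.integralCLM ℝ (volume : Measure ℝ) : 𝓢(ℝ, ℝ) →L[ℝ] ℝ).toLinearMap ∘ₗ reMulConj f

theorem pairLM_apply (f g : Sch) : pairLM f g = pair f g := (pair_eq_integral f g).symm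

theorem pair_add_right (f g h : Sch) : pair f (g + h) = pair f g + pair f h := by
  simp only [← pairLM_apply, map_add]

theorem pair_sub_right (f g h : Sch) : pair f (g - h) = pair f g - pair f h := by
  simp only [← pairLM_apply, map_sub]

theorem pair_neg_right (f g : Sch) : pair f (-g) = -pair f g := by
  simp only [← pairLM_apply, map_neg]

theorem pair_smul_right (c : ℝ) (f g : Sch) : pair f (c • g) = c * pair f g := by
  simp only [← pairLM_apply, map_smul, smul_eq_mul]

theorem pair_add_left (f g h : Sch) : pair (f + g) h = pair f h + pair g h := by
  simp only [pair_comm _ h, pair_add_right]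

theorem pair_sub_left (f g h : Sch) : pair (f - g) h = pair f h - pair g h := by
  simp only [pair_comm _ h, pair_sub_right]

theorem pair_smul_left (c : ℝ) (f g : Sch) : pair (c • f) g = c * pair f g := by
  simp only [pair_comm _ g, pair_smul_right]

/-- The pairing is the real part of the `L²` inner product, and the Schwartz space embeds
continuously in `L²`. Joint continuity is what the product rule for the pairing needs. -/
theorem continuous_pair : Continuous fun p : Sch × Sch => pair p.1 p.2 := by
  have h : Continuous fun p : Sch × Sch =>
      (inner ℂ (p.1.toLp 2 volume) (p.2.toLp 2 volume)).re :=
    Complex.continuous_re.comp ((SchwartzMap.continuous_toLp.comp continuous_fst).inner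
      (SchwartzMap.continuous_toLp.comp continuous_snd))
  refine h.congr fun p => ?_
  have hi : Integrable fun x => inner ℂ (p.1 x) (p.2 x) := by
    refine (mulConj p.2 p.1).integrable.congr (.of_forall fun x => ?_)
    simp [mulConj_apply]
  have h1 : (∫ x, inner ℂ (p.1 x) (p.2 x)).re = ∫ x, (inner ℂ (p.1 x) (p.2 x)).re :=
    (integral_re hi).symm
  refine (congrArg Complex.re (SchwartzMap.inner_toL2_toL2_eq p.1 p.2 volume)).trans ?_
  rw [h1]
  refine integral_congr_ae (.of_forall fun x => ?_)
  simp [mul_comm]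

theorem continuous_pairLM (f : Sch) : Continuous (pairLM f) := by
  simp only [funext (pairLM_apply f)]
  exact continuous_pair.comp (continuous_const.prodMk continuous_id)

theorem hasDerivAt_pair {c d : ℝ → Sch} {c' d' : Sch} (hc : HasDerivAt c c' 0)
    (hd : HasDerivAt d d' 0) :
    HasDerivAt (fun s => pair (c s) (d s)) (pair c' (d 0) + pair (c 0) d') 0 := by
  have hdc : Tendsto d (𝓝[≠] 0) (𝓝 (d 0)) :=
    (HasDerivAt.continuousAt_tvs hd).tendsto.mono_left nhdsWithin_le_nhds
  rw [hasDerivAt_zero_iff] at hc hd ⊢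
  have h := ((continuous_pair.tendsto (c', d 0)).comp (hc.prodMk_nhds hdc)).add
    ((continuous_pair.tendsto (c 0, d')).comp (tendsto_const_nhds.prodMk_nhds hd))
  refine h.congr fun s => ?_
  simp only [Function.comp_apply, pair_smul_left, pair_smul_right, pair_sub_left, pair_sub_right,
    smul_eq_mul]
  ring

theorem hasDerivAt_pair_right (f : Sch) {d : ℝ → Sch} {d' : Sch} (hd : HasDerivAt d d' 0) :
    HasDerivAt (fun s => pair f (d s)) (pair f d') 0 := by
  simpa only [pairLM_apply] using hasDerivAt_clm_comp_tvs (continuous_pairLM f) hd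

/-- A sum of pairings vanishes if its integrand is an `x`-derivative. -/
theorem sum_pair_eq_zero {n : ℕ} (f g : Fin n → Sch) (S : Sch)
    (h : ∀ x, ∑ i, reMulConj (f i) (g i) x = (deriv S x).re) : ∑ i, pair (f i) (g i) = 0 := by
  simp only [pair_eq_integral]
  rw [← integral_finsetSum _ fun i _ => (reMulConj (f i) (g i)).integrable]
  simp only [h]
  exact integral_deriv_re_eq_zero S

theorem deriv_mulConj (f g : Sch) (x : ℝ) : deriv (mulConj f g) x =
    deriv f x * starRingEnd ℂ (g x) + f x * starRingEnd ℂ (deriv g x) :=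
  ((f.hasDerivAt x).mul
    (((Complex.conjCLE : ℂ →L[ℝ] ℂ).hasFDerivAt).comp_hasDerivAt x (g.hasDerivAt x))).deriv

theorem pair_opD (f g : Sch) : pair f (opD g) = -pair g (opD f) := by
  have h := sum_pair_eq_zero ![f, g] ![opD g, opD f] (mulConj f g) fun x => by
    rw [deriv_mulConj]
    simp [Fin.sum_univ_two, reMulConj_apply, opD_apply]
    ring
  simp only [Fin.sum_univ_two, Matrix.cons_val_zero, Matrix.cons_val_one] at h
  linarith

/-! ### The nonlocal operators `f ↦ a D_x⁻¹ Re(b f̄)` -/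

/-- `f ↦ a D_x⁻¹ Re(b f̄)`. -/
def nonlocal (a b : Sch) : Sch →ₗ[ℝ] Sch := mulDxInv a ∘ₗ reMulConj b

theorem nonlocal_apply (a b f : Sch) (x : ℝ) :
    nonlocal a b f x = a x * (dxInv (reMulConj b f) x : ℂ) :=
  mulDxInv_apply a (reMulConj b f) x

theorem continuous_nonlocal (a b : Sch) : Continuous (nonlocal a b) :=
  (continuous_mulDxInv a).comp (continuous_reMulConj b)

theorem reMulConj_add_left (a b f : Sch) : reMulConj (a + b) f = reMulConj a f + reMulConj b f := by
  ext x
  simp only [reMulConj_apply, add_apply, Complex.add_re, Complex.add_im]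
  ring

theorem reMulConj_smul_left (c : ℝ) (a f : Sch) : reMulConj (c • a) f = c • reMulConj a f := by
  ext x
  simp [reMulConj_apply]
  ring

theorem reMulConj_comm (a b : Sch) : reMulConj a b = reMulConj b a := by
  ext x
  simp only [reMulConj_apply]
  ring

theorem nonlocal_add_left (a a' b f : Sch) :
    nonlocal (a + a') b f = nonlocal a b f + nonlocal a' b f :=
  mulDxInv_add_left a a' _

theorem nonlocal_smul_left (c : ℝ) (a b f : Sch) : nonlocal (c • a) b f = c • nonlocal a b f :=
  mulDxInv_smul_left c a _

theorem nonlocal_add_right (a b b' f : Sch) :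
    nonlocal a (b + b') f = nonlocal a b f + nonlocal a b' f := by
  simp [nonlocal, reMulConj_add_left]

theorem nonlocal_smul_right (c : ℝ) (a b f : Sch) : nonlocal a (c • b) f = c • nonlocal a b f := by
  simp [nonlocal, reMulConj_smul_left]

theorem pair_nonlocal_eq (f a b g : Sch) :
    pair f (nonlocal a b g) = ∫ x, reMulConj f a x * dxInv (reMulConj b g) x := by
  rw [pair_eq_integral]
  refine integral_congr_ae (.of_forall fun x => ?_)
  simp [reMulConj_apply, nonlocal_apply]
  ring

theorem pair_nonlocal_skew (f a b g : Sch) :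
    pair f (nonlocal a b g) = -pair g (nonlocal b a f) := by
  rw [pair_nonlocal_eq, pair_nonlocal_eq, integral_mul_dxInv_skew, reMulConj_comm b g,
    reMulConj_comm f a]

theorem pair_nonlocal_swap (f a b g : Sch) :
    pair f (nonlocal a b g) = pair a (nonlocal f b g) := by
  rw [pair_nonlocal_eq, pair_nonlocal_eq, reMulConj_comm f a]

/-- `D_x - (L u) D_x⁻¹ Re((L u) 𝒞)`. -/
def quadOp (L : Sch →ₗ[ℝ] Sch) (u : Sch) : Sch →ₗ[ℝ] Sch := opD - nonlocal (L u) (L u)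

/-- The derivative of `quadOp L u` with respect to `u` in the direction `v`. -/
def quadOpDeriv (L : Sch →ₗ[ℝ] Sch) (u v : Sch) : Sch →ₗ[ℝ] Sch :=
  -(nonlocal (L u) (L v) + nonlocal (L v) (L u))

theorem opJ_eq_quadOp (u : Sch) : opJ u = quadOp LinearMap.id u := rfl

theorem opH_eq_quadOp (u : Sch) : opH u = quadOp (opMul Complex.I) u := by
  have h : ∀ f, reMulConj (opMul Complex.I u) f = -imMulConj u f := fun f => by
    ext x
    have h : imMulConj u f x = (u x * starRingEnd ℂ (f x)).im := rfl
    simp [reMulConj_apply, h, opMul_apply]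
  ext f x
  change opD f x + Complex.I * mulDxInv u (imMulConj u f) x =
    opD f x - mulDxInv (opMul Complex.I u) (reMulConj (opMul Complex.I u) f) x
  rw [h, map_neg, neg_apply, mulDxInv_apply, mulDxInv_apply, opMul_apply]
  ring

theorem continuous_quadOp (L : Sch →ₗ[ℝ] Sch) (u : Sch) : Continuous (quadOp L u) :=
  continuous_opD.sub (continuous_nonlocal _ _)

theorem hasDerivAt_quadOp (L : Sch →ₗ[ℝ] Sch) (u v : Sch) {c : ℝ → Sch} {c' : Sch}
    (hc : HasDerivAt c c' 0) :
    HasDerivAt (fun s : ℝ => quadOp L (u + s • v) (c s))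
      (quadOp L u c' + quadOpDeriv L u v (c 0)) 0 := by
  -- Along the line `u + s v` the operator is a polynomial of degree two in `s`, each coefficient
  -- being continuous in its argument.
  have h := hasDerivAt_quadratic (L₁ := quadOpDeriv L u v) (L₂ := -nonlocal (L v) (L v))
    (continuous_quadOp L u)
    ((continuous_nonlocal (L u) (L v)).add (continuous_nonlocal (L v) (L u))).neg
    (continuous_nonlocal (L v) (L v)).neg hc
  convert h using 2 with s
  simp only [quadOp, quadOpDeriv, LinearMap.sub_apply, LinearMap.neg_apply, LinearMap.add_apply,
    map_add, map_smul, nonlocal_add_left, nonlocal_add_right, nonlocal_smul_left,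
    nonlocal_smul_right]
  module

theorem pair_quadOp_skew (L : Sch →ₗ[ℝ] Sch) (u f g : Sch) :
    pair f (quadOp L u g) = -pair g (quadOp L u f) := by
  simp only [quadOp, LinearMap.sub_apply, pair_sub_right]
  rw [pair_opD, pair_nonlocal_skew]
  ring

/-- The covector `w` with `⟨f, (quadOpDeriv L u v) g⟩ = ⟨L v, w⟩`. -/
def quadOpForm (L : Sch →ₗ[ℝ] Sch) (u f g : Sch) : Sch := nonlocal g (L u) f - nonlocal f (L u) g

/-- Both terms of the variation are linear in `L v`; skew-adjointness of `D_x⁻¹` and exchange of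
outer factors bring `L v` to the outside of the pairing. -/
theorem pair_quadOpDeriv (L : Sch →ₗ[ℝ] Sch) (u v f g : Sch) :
    pair f (quadOpDeriv L u v g) = pair (L v) (quadOpForm L u f g) := by
  simp only [quadOpDeriv, quadOpForm, LinearMap.neg_apply, LinearMap.add_apply, pair_neg_right,
    pair_add_right, pair_sub_right]
  rw [pair_nonlocal_skew f, pair_nonlocal_swap g, pair_nonlocal_swap f]
  ring

/-! ### Cyclic identities -/

theorem opD_mulDxInv_apply (u : Sch) (g : 𝓢(ℝ, ℝ)) (x : ℝ) :
    opD (mulDxInv u g) x = opD u x * (dxInv g x : ℂ) + u x * (g x : ℂ) :=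
  deriv_mulDxInv u g x

theorem opD_mulConj_apply (f g : Sch) (x : ℝ) : opD (mulConj f g) x =
    opD f x * starRingEnd ℂ (g x) + f x * starRingEnd ℂ (opD g x) :=
  deriv_mulConj f g x

theorem opD_opMul (c : ℂ) (f : Sch) : opD (opMul c f) = opMul c (opD f) :=
  (SchwartzMap.derivCLM ℂ ℂ).map_smul c f

theorem quadOp_apply (L : Sch →ₗ[ℝ] Sch) (u f : Sch) (x : ℝ) :
    quadOp L u f x = opD f x - L u x * (dxInv (reMulConj (L u) f) x : ℂ) := by
  rw [← nonlocal_apply]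
  rfl

theorem quadOpForm_apply (L : Sch →ₗ[ℝ] Sch) (u f g : Sch) (x : ℝ) :
    quadOpForm L u f g x =
      g x * (dxInv (reMulConj (L u) f) x : ℂ) - f x * (dxInv (reMulConj (L u) g) x : ℂ) := by
  rw [← nonlocal_apply, ← nonlocal_apply]
  rfl

/-- The integrand cancels pointwise, so the primitive is `0`. This gives both the closedness of `𝒥`
and the mixed terms of `ℋ` and `ℐ`. -/
theorem cyclic_quadOpForm (L : Sch →ₗ[ℝ] Sch) (u f₁ f₂ f₃ : Sch) :
    pair f₂ (quadOpForm L u f₁ f₃) + pair f₃ (quadOpForm L u f₂ f₁) +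
      pair f₁ (quadOpForm L u f₃ f₂) = 0 := by
  have h := sum_pair_eq_zero ![f₂, f₃, f₁]
    ![quadOpForm L u f₁ f₃, quadOpForm L u f₂ f₁, quadOpForm L u f₃ f₂] 0 fun x => by
      change _ = (opD 0 x).re
      simp [Fin.sum_univ_three, reMulConj_apply, quadOpForm_apply]
      ring
  simpa [Fin.sum_univ_three] using h

/-- The Jacobi identity of `ℋ`. With `p_k = D_x⁻¹ Re(iu f̄_k)`, the primitive is the cyclic sum of
`i f₁ f̄₂ p₃`. Terms quadratic in the `p_k` telescope, and the terms without `p_k` vanish because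
the cyclic sum of `Im(f₁ f̄₂) f₃` is zero for any three vectors in the plane. -/
theorem cyclic_quadOpForm_opH (u f₁ f₂ f₃ : Sch) :
    pair (opMul Complex.I (opH u f₂)) (quadOpForm (opMul Complex.I) u f₁ f₃) +
      pair (opMul Complex.I (opH u f₃)) (quadOpForm (opMul Complex.I) u f₂ f₁) +
      pair (opMul Complex.I (opH u f₁)) (quadOpForm (opMul Complex.I) u f₃ f₂) = 0 := by
  have h := sum_pair_eq_zero
    ![opMul Complex.I (opH u f₂), opMul Complex.I (opH u f₃), opMul Complex.I (opH u f₁)]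
    ![quadOpForm (opMul Complex.I) u f₁ f₃, quadOpForm (opMul Complex.I) u f₂ f₁,
      quadOpForm (opMul Complex.I) u f₃ f₂]
    (mulDxInv (mulConj (opMul Complex.I f₁) f₂) (reMulConj (opMul Complex.I u) f₃) +
      mulDxInv (mulConj (opMul Complex.I f₂) f₃) (reMulConj (opMul Complex.I u) f₁) +
      mulDxInv (mulConj (opMul Complex.I f₃) f₁) (reMulConj (opMul Complex.I u) f₂)) fun x => by
      rw [← opD_apply, map_add, map_add, add_apply, add_apply]
      simp [Fin.sum_univ_three, reMulConj_apply, quadOpForm_apply, opD_mulDxInv_apply,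
        opD_mulConj_apply, opH_eq_quadOp, quadOp_apply, opMul_apply, opD_opMul, mulConj_apply]
      ring
  simpa [Fin.sum_univ_three] using h

/-- The mixed term of `ℐ` and `𝒥⁻¹`. The mechanism is that of `cyclic_quadOpForm_opH`, now with `p_k
= D_x⁻¹ Re(u w̄_k)`. -/
theorem cyclic_quadOpForm_opI (u w₁ w₂ w₃ : Sch) :
    pair (opI (opJ u w₂)) (quadOpForm LinearMap.id u w₁ w₃) +
      pair (opI (opJ u w₃)) (quadOpForm LinearMap.id u w₂ w₁) +
      pair (opI (opJ u w₁)) (quadOpForm LinearMap.id u w₃ w₂) = 0 := by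
  have h := sum_pair_eq_zero
    ![opI (opJ u w₂), opI (opJ u w₃), opI (opJ u w₁)]
    ![quadOpForm LinearMap.id u w₁ w₃, quadOpForm LinearMap.id u w₂ w₁,
      quadOpForm LinearMap.id u w₃ w₂]
    (-(mulDxInv (mulConj (opMul Complex.I w₁) w₂) (reMulConj u w₃) +
      mulDxInv (mulConj (opMul Complex.I w₂) w₃) (reMulConj u w₁) +
      mulDxInv (mulConj (opMul Complex.I w₃) w₁) (reMulConj u w₂))) fun x => by
      rw [← opD_apply, map_neg, neg_apply, map_add, map_add, add_apply, add_apply]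
      simp [Fin.sum_univ_three, reMulConj_apply, quadOpForm_apply, opD_mulDxInv_apply,
        opD_mulConj_apply, opJ_eq_quadOp, quadOp_apply, opMul_apply, opD_opMul, mulConj_apply,
        opI_apply]
      ring
  simpa [Fin.sum_univ_three] using h

/-- The mixed term of `ℋ` and `𝒥⁻¹`. Let `p_k = D_x⁻¹ Re(u w̄_k)` and let `q_k = D_x⁻¹ Re(iu f̄_k)`
with `f_k = 𝒥 w_k`. Products `p_j q_k` cancel between the two brackets. The primitive combines `i w₁
w̄₂ q₃` with the Wronskian terms `(w₁' w̄₂ - w₁ w̄₂') p₃`, which absorb the second derivatives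
coming from `ℋ𝒥`. -/
theorem cyclic_quadOpForm_opH_opJ (u w₁ w₂ w₃ : Sch) :
    (pair (opMul Complex.I w₂) (quadOpForm (opMul Complex.I) u (opJ u w₁) (opJ u w₃)) +
      pair (opMul Complex.I w₃) (quadOpForm (opMul Complex.I) u (opJ u w₂) (opJ u w₁)) +
      pair (opMul Complex.I w₁) (quadOpForm (opMul Complex.I) u (opJ u w₃) (opJ u w₂))) +
    (pair (opH u (opJ u w₂)) (quadOpForm LinearMap.id u w₁ w₃) +
      pair (opH u (opJ u w₃)) (quadOpForm LinearMap.id u w₂ w₁) +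
      pair (opH u (opJ u w₁)) (quadOpForm LinearMap.id u w₃ w₂)) = 0 := by
  have h := sum_pair_eq_zero
    ![opMul Complex.I w₂, opMul Complex.I w₃, opMul Complex.I w₁,
      opH u (opJ u w₂), opH u (opJ u w₃), opH u (opJ u w₁)]
    ![quadOpForm (opMul Complex.I) u (opJ u w₁) (opJ u w₃),
      quadOpForm (opMul Complex.I) u (opJ u w₂) (opJ u w₁),
      quadOpForm (opMul Complex.I) u (opJ u w₃) (opJ u w₂),
      quadOpForm LinearMap.id u w₁ w₃, quadOpForm LinearMap.id u w₂ w₁,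
      quadOpForm LinearMap.id u w₃ w₂]
    ((mulDxInv (mulConj (opMul Complex.I w₁) w₂) (reMulConj (opMul Complex.I u) (opJ u w₃)) +
      mulDxInv (mulConj (opMul Complex.I w₂) w₃) (reMulConj (opMul Complex.I u) (opJ u w₁)) +
      mulDxInv (mulConj (opMul Complex.I w₃) w₁) (reMulConj (opMul Complex.I u) (opJ u w₂))) +
     (mulDxInv (mulConj (opD w₁) w₂ - mulConj w₁ (opD w₂)) (reMulConj u w₃) +
      mulDxInv (mulConj (opD w₂) w₃ - mulConj w₂ (opD w₃)) (reMulConj u w₁) +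
      mulDxInv (mulConj (opD w₃) w₁ - mulConj w₃ (opD w₁)) (reMulConj u w₂))) fun x => by
      rw [← opD_apply]
      have hJ : ∀ w, opD (quadOp LinearMap.id u w) x = opD (opD w) x - (opD u x * (dxInv (reMulConj u w) x : ℂ) +
          u x * (reMulConj u w x : ℂ)) := fun w => by
        rw [← opD_mulDxInv_apply]
        exact congrArg (· x) (map_sub opD (opD w) (mulDxInv u (reMulConj u w)))
      simp only [map_add, map_sub, add_apply, sub_apply, opD_mulDxInv_apply, opD_mulConj_apply,
        opH_eq_quadOp, opD_opMul]
      simp [Fin.sum_univ_six, reMulConj_apply, quadOpForm_apply, opJ_eq_quadOp, quadOp_apply,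
        opMul_apply, mulConj_apply, hJ]
      ring
  simp only [Fin.sum_univ_six] at h
  simpa [add_assoc] using h

/-! ### Hamiltonian operators -/

section Hessian

variable {F : Sch → ℝ} {g : Sch → Sch}

theorem IsVarDeriv.hasDerivAt (h : IsVarDeriv F g) (u v : Sch) (t : ℝ) :
    HasDerivAt (fun s : ℝ => F (u + s • v)) (2 * pair (g (u + t • v)) v) t := by
  have h1 := h (u + t • v) v
  have h2 : HasDerivAt (fun s : ℝ => s - t) 1 t := (hasDerivAt_id t).sub_const t
  rw [← sub_self t] at h1
  have h3 := HasDerivAt.comp (h := fun s : ℝ => s - t) t h1 h2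
  rw [mul_one] at h3
  refine h3.congr_of_eventuallyEq (.of_forall fun s => ?_)
  simp only [Function.comp_apply, sub_smul]
  congr 1
  abel

/-- The second variational derivative of a functional is symmetric. -/
theorem IsVarDeriv.hessian_symm (h : IsVarDeriv F g) {u : Sch} {A : Sch →L[ℝ] Sch}
    (hg : Differentiable ℝ g) (hA : HasFDerivAt g A u) (v w : Sch) :
    pair (A v) w = pair (A w) v := by
  -- Restriction to the plane `u + a v + b w` reduces the claim to the symmetry of second
  -- derivatives on `ℝ²`.
  let P : ℝ × ℝ →L[ℝ] Sch := (ContinuousLinearMap.fst ℝ ℝ ℝ).smulRight v +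
    (ContinuousLinearMap.snd ℝ ℝ ℝ).smulRight w
  have hP : ∀ p, HasFDerivAt (fun p : ℝ × ℝ => u + P p) P p := fun p => by
    rw [hasFDerivAt_iff_isLittleOTVS_sub]
    refine (Asymptotics.IsLittleOTVS.zero _ _).congr_left fun q => ?_
    rw [map_sub, Pi.zero_apply]
    abel
  have hG : ∀ (p : ℝ × ℝ) (B : Sch →L[ℝ] Sch) (z : Sch), HasFDerivAt g B (u + P p) →
      HasFDerivAt (fun p => pair (g (u + P p)) z)
        ((⟨pairLM z, continuous_pairLM z⟩ : Sch →L[ℝ] ℝ).comp (B.comp P)) p := by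
    intro p B z hB
    have h1 := hasFDerivAt_comp_tvs
      (ContinuousLinearMap.hasFDerivAt (⟨pairLM z, continuous_pairLM z⟩ : Sch →L[ℝ] ℝ))
      (hasFDerivAt_comp_tvs (f := fun p => u + P p) hB (hP p))
    refine h1.congr_of_eventuallyEq (.of_forall fun q => ?_)
    exact (pair_comm _ _).trans (pairLM_apply z _).symm
  have hcont : ∀ (p : ℝ × ℝ) (z : Sch), ContinuousAt (fun p => pair (g (u + P p)) z) p :=
    fun p z => (hG p _ z (hg _).choose_spec).continuousAt
  have hPs : ∀ a b : ℝ, P (a, b) = a • v + b • w := fun a b => rfl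
  -- The two partial derivatives are continuous because `g` is differentiable, so the restriction is
  -- differentiable jointly in both parameters.
  have hφ : ∀ p : ℝ × ℝ, HasFDerivAt (fun p : ℝ × ℝ => F (u + P p))
      ((2 * pair (g (u + P p)) v) • ContinuousLinearMap.fst ℝ ℝ ℝ +
        (2 * pair (g (u + P p)) w) • ContinuousLinearMap.snd ℝ ℝ ℝ) p := by
    intro p
    have h := hasStrictFDerivAt_uncurry_coprod (𝕜 := ℝ) (u := p)
      (f := fun a b : ℝ => F (u + P (a, b)))
      (f₁ := fun a b => (2 * pair (g (u + P (a, b))) v) • ContinuousLinearMap.id ℝ ℝ)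
      (f₂ := fun a b => (2 * pair (g (u + P (a, b))) w) • ContinuousLinearMap.id ℝ ℝ)
      (.of_forall fun q => by
        have h1 := (h.hasDerivAt (u + q.2 • w) v q.1).hasFDerivAt
        have h2 : ∀ a : ℝ, u + q.2 • w + a • v = u + P (a, q.2) := fun a => by rw [hPs]; abel
        simp only [h2] at h1
        exact h1.congr_fderiv (by ext; simp [Function.HasUncurry.uncurry]))
      (.of_forall fun q => by
        have h1 := (h.hasDerivAt (u + q.1 • v) w q.2).hasFDerivAt
        have h2 : ∀ a : ℝ, u + q.1 • v + a • w = u + P (q.1, a) := fun a => by rw [hPs]; abel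
        simp only [h2] at h1
        exact h1.congr_fderiv (by ext; simp [Function.HasUncurry.uncurry]))
      ((continuousAt_const.mul (hcont p v)).smul continuousAt_const)
      ((continuousAt_const.mul (hcont p w)).smul continuousAt_const)
    exact h.hasFDerivAt.congr_fderiv (by ext <;> simp [Function.HasUncurry.uncurry])
  have h0 : u + P 0 = u := by simp
  have h2 := second_derivative_symmetric hφ
    ((((hG 0 A v (by rwa [h0])).const_mul 2).smul_const (ContinuousLinearMap.fst ℝ ℝ ℝ)).add
      (((hG 0 A w (by rwa [h0])).const_mul 2).smul_const (ContinuousLinearMap.snd ℝ ℝ ℝ)))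
    (1, 0) (0, 1)
  have h3 : pair w (A v) = pair v (A w) := by
    simpa [hPs, pairLM_apply] using h2
  rw [pair_comm, h3, pair_comm]

end Hessian

/-- A criterion for an operator to be Hamiltonian, in terms of its derivative `D'` with respect to
`u`. -/
theorem isHamiltonian_of_cyclic {D : Op} {D' : Sch → Sch → Sch →ₗ[ℝ] Sch}
    {m : Sch → Sch → Sch → Sch}
    (hD : ∀ (u v : Sch) (c : ℝ → Sch) (c' : Sch), HasDerivAt c c' 0 →
      HasDerivAt (fun s : ℝ => D (u + s • v) (c s)) (D u c' + D' u v (c 0)) 0)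
    (hskew : ∀ u f g, pair f (D u g) = -pair g (D u f))
    (hm : ∀ u v f g, pair f (D' u v g) = pair v (m u f g))
    (hcyc : ∀ u f₁ f₂ f₃, pair f₁ (D' u (D u f₂) f₃) + pair f₂ (D' u (D u f₃) f₁) +
      pair f₃ (D' u (D u f₁) f₂) = 0) : IsHamiltonian D := by
  refine ⟨fun F G u => by simp only [bracket]; rw [hskew]; ring, fun F G L => ?_⟩
  have hess : ∀ F : Functional, ∃ A : Sch → Sch →L[ℝ] Sch, (∀ u, HasFDerivAt F.grad (A u) u) ∧
      ∀ u v w, pair (A u v) w = pair (A u w) v := fun F => by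
    choose A hA using fun u => F.differentiable u
    exact ⟨A, hA, fun u => F.isVarDeriv.hessian_symm F.differentiable (hA u)⟩
  -- The Hessians `A` and `B` are symmetric and `D` is skew, so all three terms of the derivative
  -- can be written as pairings with `v`. The factor `1/2` offsets the `2` in the definition of the
  -- variational derivative.
  have hvar : ∀ (F G : Functional) (A B : Sch → Sch →L[ℝ] Sch),
      (∀ u, HasFDerivAt F.grad (A u) u) → (∀ u v w, pair (A u v) w = pair (A u w) v) →
      (∀ u, HasFDerivAt G.grad (B u) u) → (∀ u v w, pair (B u v) w = pair (B u w) v) →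
      IsVarDeriv (bracket D F.grad G.grad) fun u => (1 / 2 : ℝ) •
        (A u (D u (G.grad u)) - B u (D u (F.grad u)) + m u (F.grad u) (G.grad u)) := by
    intro F G A B hA hAs hB hBs u v
    have hline : ∀ {g : Sch → Sch} {C : Sch →L[ℝ] Sch}, HasFDerivAt g C u →
        HasDerivAt (fun s : ℝ => g (u + s • v)) (C v) 0 := fun hC =>
      hasDerivAt_comp_tvs (by simpa using hC) (hasDerivAt_line u v)
    have h := hasDerivAt_pair (hline (hA u)) (hD u v _ _ (hline (hB u)))
    simp only [zero_smul, add_zero] at h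
    change HasDerivAt (fun s => bracket D F.grad G.grad (u + s • v)) _ 0
    refine h.congr_deriv ?_
    rw [pair_smul_left, pair_add_left, pair_sub_left, pair_add_right, hm, hAs, hBs,
      hskew u (F.grad u), pair_comm (m _ _ _)]
    ring
  obtain ⟨A, hA, hAs⟩ := hess F
  obtain ⟨B, hB, hBs⟩ := hess G
  obtain ⟨C, hC, hCs⟩ := hess L
  refine ⟨_, _, _, hvar F G A B hA hAs hB hBs, hvar G L B C hB hBs hC hCs,
    hvar L F C A hC hCs hA hAs, fun u => ?_⟩
  simp only [bracket, pair_smul_left, pair_add_left, pair_sub_left, pair_comm (m _ _ _) _, ← hm]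
  have h := hcyc u (F.grad u) (L.grad u) (G.grad u)
  -- Each Hessian occurs twice in the cyclic sum, with opposite signs and its two arguments
  -- exchanged.
  rw [hAs u (D u (L.grad u)), hBs u (D u (L.grad u)),
    hCs u (D u (F.grad u))]
  linarith

/-! ### The Hamiltonian pair `ℋ`, `ℐ` -/

theorem pair_opI_skew (f g : Sch) : pair f (opI g) = -pair g (opI f) := by
  rw [pair_eq_integral, pair_eq_integral, ← integral_neg]
  refine integral_congr_ae (.of_forall fun x => ?_)
  simp [reMulConj_apply, opI_apply]
  ring

theorem continuous_opI : Continuous opI.toLinearMap := continuous_const_smul (-Complex.I)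

theorem opMul_I_opI (f : Sch) : opMul Complex.I (opI f) = f := by
  ext x
  rw [opMul_apply, opI_apply, ← mul_assoc]
  simp

/-- All real linear combinations of `ℋ` and `ℐ` are Hamiltonian. -/
theorem isHamiltonian_opH_add_opI (c₁ c₂ : ℝ) :
    IsHamiltonian fun u => c₁ • opH u + c₂ • opI.toLinearMap := by
  -- Only `ℋ` depends on `u`. The factor `-i` in `m` is the adjoint of `L = i` for the real pairing.
  refine isHamiltonian_of_cyclic
    (D' := fun u v => c₁ • quadOpDeriv (opMul Complex.I) u v)
    (m := fun u f g => c₁ • -opMul Complex.I (quadOpForm (opMul Complex.I) u f g)) ?_ ?_ ?_ ?_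
  · intro u v c c' hc
    have h1 := hasDerivAt_clm_comp_tvs (L := c₁ • LinearMap.id) (continuous_const_smul c₁)
      (hasDerivAt_quadOp (opMul Complex.I) u v hc)
    have h2 := hasDerivAt_clm_comp_tvs (L := c₂ • opI.toLinearMap)
      (continuous_opI.const_smul c₂) hc
    convert hasDerivAt_add_tvs h1 h2 using 1
    · simp only [opH_eq_quadOp]
      rfl
    · simp only [opH_eq_quadOp, LinearMap.add_apply, LinearMap.smul_apply, smul_add,
        LinearMap.id_apply]
      abel
  · intro u f g
    simp only [LinearMap.add_apply, LinearMap.smul_apply, pair_add_right, pair_smul_right,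
      LinearEquiv.coe_coe]
    rw [opH_eq_quadOp, pair_quadOp_skew, pair_opI_skew]
    ring
  · intro u v f g
    rw [LinearMap.smul_apply, pair_smul_right, pair_smul_right, pair_quadOpDeriv]
    congr 1
    rw [pair_eq_integral, pair_eq_integral]
    refine integral_congr_ae (.of_forall fun x => ?_)
    simp [reMulConj_apply, opMul_apply]
  · intro u f₁ f₂ f₃
    have h1 := cyclic_quadOpForm_opH u f₁ f₂ f₃
    have h2 := cyclic_quadOpForm (opMul Complex.I) u f₁ f₂ f₃
    simp only [LinearMap.smul_apply, LinearMap.add_apply, pair_smul_right, pair_quadOpDeriv,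
      map_add, map_smul, pair_add_left, pair_smul_left, LinearEquiv.coe_coe, opMul_I_opI]
    linear_combination c₁ ^ 2 * h1 + c₁ * c₂ * h2

theorem isHamiltonian_opH : IsHamiltonian opH := by
  simpa using isHamiltonian_opH_add_opI 1 0

theorem isHamiltonian_opI : IsHamiltonian fun _ => opI.toLinearMap := by
  simpa using isHamiltonian_opH_add_opI 0 1

/-! ### The symplectic operator `𝒥` -/

/-- `(ℋ, ℐ)` is compatible with the symplectic operator `𝒥`. -/
theorem isHamiltonianFraction_opH_opI_opJ (hinj : ∀ u, Function.Injective (opJ u)) (c₀ c₁ c₂ : ℝ) :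
    IsHamiltonianFraction (fun u => (c₁ • opH u + c₀ • opI.toLinearMap) ∘ₗ opJ u +
      c₂ • LinearMap.id) opJ := by
  have hskew : ∀ u f g : Sch, pair f ((c₁ • opH u + c₀ • opI.toLinearMap) g) =
      -pair g ((c₁ • opH u + c₀ • opI.toLinearMap) f) := fun u f g => by
    simp only [LinearMap.add_apply, LinearMap.smul_apply, pair_add_right, pair_smul_right,
      LinearEquiv.coe_coe]
    rw [opH_eq_quadOp, pair_quadOp_skew, pair_opI_skew]
    ring
  refine ⟨hinj, fun u w₁ w₂ => ?_, fun u w₁ w₂ w₃ =>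
    c₁ * pair (opMul Complex.I (c₁ • opH u (opJ u w₂) + c₀ • opI (opJ u w₂) + c₂ • w₂))
      (quadOpForm (opMul Complex.I) u (opJ u w₁) (opJ u w₃)) +
    c₂ * pair (c₁ • opH u (opJ u w₂) + c₀ • opI (opJ u w₂) + c₂ • w₂)
      (quadOpForm LinearMap.id u w₁ w₃), fun u w₁ w₂ w₃ => ?_, fun u w₁ w₂ w₃ => ?_⟩
  · simp only [LinearMap.add_apply _ (c₂ • LinearMap.id), LinearMap.comp_apply, pair_add_right]
    rw [hskew u (opJ u w₂) (opJ u w₁)]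
    simp only [LinearMap.smul_apply, LinearMap.id_apply, pair_smul_right, opJ_eq_quadOp]
    rw [pair_comm _ w₂, pair_quadOp_skew, pair_comm w₁]
    ring
  · simp only [opJ_eq_quadOp, opH_eq_quadOp] at hskew ⊢
    set v := c₁ • quadOp (opMul Complex.I) u (quadOp LinearMap.id u w₂) +
      c₀ • opI (quadOp LinearMap.id u w₂) + c₂ • w₂
    have hc : HasDerivAt (fun _ : ℝ => w₃) 0 0 := by
      rw [hasDerivAt_zero_iff]
      simp
    have hJ := hasDerivAt_quadOp LinearMap.id u v hc
    rw [map_zero, zero_add] at hJ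
    have h1 := hasDerivAt_clm_comp_tvs (L := c₁ • LinearMap.id) (continuous_const_smul c₁)
      (hasDerivAt_quadOp (opMul Complex.I) u v hJ)
    have h2 := hasDerivAt_clm_comp_tvs (L := c₀ • opI.toLinearMap)
      (continuous_opI.const_smul c₀) hJ
    have h3 := hasDerivAt_clm_comp_tvs (L := c₂ • LinearMap.id) (continuous_const_smul c₂) hc
    have h := (hasDerivAt_pair_right (quadOp LinearMap.id u w₁) (hasDerivAt_add_tvs (hasDerivAt_add_tvs h1 h2)
      h3)).add (hasDerivAt_pair_right
        ((c₁ • quadOp (opMul Complex.I) u + c₀ • opI.toLinearMap) (quadOp LinearMap.id u w₁) +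
          c₂ • w₁) hJ)
    refine h.congr_deriv ?_
    -- Skew symmetry of `c₁ ℋ + c₀ ℐ` cancels the two terms in which it meets the variation of `𝒥`;
    -- only the variation of `ℋ` and the `c₂` term survive.
    have h4 := hskew u (quadOp LinearMap.id u w₁) (quadOpDeriv LinearMap.id u v w₃)
    simp only [LinearMap.add_apply, LinearMap.smul_apply,
      pair_add_right, pair_smul_right] at h4
    simp only [LinearMap.smul_apply, LinearMap.id_apply, LinearMap.add_apply, pair_add_right,
      pair_smul_right, zero_smul, add_zero, smul_zero,
      pair_comm _ (quadOpDeriv LinearMap.id u v w₃)]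
    rw [pair_quadOpDeriv, pair_comm _ w₁, pair_quadOpDeriv, LinearMap.id_apply]
    linear_combination h4
  -- The cyclic sum is a quadratic polynomial in `c₀, c₁, c₂`. Its `c₀²` coefficient is absent
  -- because `ℐ` is constant; the five others vanish separately.
  · have h1 := cyclic_quadOpForm_opH u (opJ u w₁) (opJ u w₂) (opJ u w₃)
    have h2 := cyclic_quadOpForm (opMul Complex.I) u (opJ u w₁) (opJ u w₂) (opJ u w₃)
    have h3 := cyclic_quadOpForm LinearMap.id u w₁ w₂ w₃
    have h4 := cyclic_quadOpForm_opI u w₁ w₂ w₃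
    have h5 := cyclic_quadOpForm_opH_opJ u w₁ w₂ w₃
    simp only [map_add, map_smul, pair_add_left, pair_smul_left, opMul_I_opI]
    linear_combination c₁ ^ 2 * h1 + c₁ * c₀ * h2 + c₂ ^ 2 * h3 + c₀ * c₂ * h4 + c₁ * c₂ * h5

theorem isSymplectic_opJ (hinj : ∀ u, Function.Injective (opJ u)) : IsSymplectic opJ := by
  refine ⟨hinj, fun u w₁ w₂ => ?_, fun u w₁ w₂ w₃ => pair w₂ (quadOpForm LinearMap.id u w₁ w₃),
    fun u w₁ w₂ w₃ => ?_, fun u w₁ w₂ w₃ => cyclic_quadOpForm LinearMap.id u w₁ w₂ w₃⟩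
  · rw [opJ_eq_quadOp, pair_quadOp_skew]
    ring
  · have hc : HasDerivAt (fun _ : ℝ => w₃) 0 0 := by
      rw [hasDerivAt_zero_iff]
      simp
    have h := hasDerivAt_pair_right w₁ (hasDerivAt_quadOp LinearMap.id u w₂ hc)
    rwa [map_zero, zero_add, pair_quadOpDeriv] at h

/-! ### Injectivity of `𝒥` -/

/-- Grönwall's argument started at `-∞`: `q e^{-N}` is nonincreasing, and it tends to `0` at `-∞`
because `N` is bounded. -/
theorem eq_zero_of_hasDerivAt_le {q N : ℝ → ℝ} {q' n : ℝ → ℝ} {C : ℝ}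
    (hq : ∀ x, HasDerivAt q (q' x) x) (hN : ∀ x, HasDerivAt N (n x) x) (h0 : ∀ x, 0 ≤ q x)
    (hle : ∀ x, q' x ≤ n x * q x) (hC : ∀ x, |N x| ≤ C) (hlim : Tendsto q atBot (𝓝 0)) (x : ℝ) :
    q x = 0 := by
  have hd : ∀ x, HasDerivAt (fun y => q y * Real.exp (-N y))
      (q' x * Real.exp (-N x) + q x * (Real.exp (-N x) * -n x)) x := fun x =>
    (hq x).mul (hN x).neg.exp
  have hanti : Antitone fun y => q y * Real.exp (-N y) := by
    refine antitone_of_hasDerivAt_nonpos hd fun y => ?_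
    have h1 := mul_le_mul_of_nonneg_right (hle y) (Real.exp_pos (-N y)).le
    simp only [Pi.zero_apply]
    linarith
  have hl : Tendsto (fun y => q y * Real.exp (-N y)) atBot (𝓝 0) := by
    refine squeeze_zero (fun y => mul_nonneg (h0 y) (Real.exp_pos _).le) (fun y => ?_)
      (by simpa using hlim.mul_const (Real.exp C))
    exact mul_le_mul_of_nonneg_left (Real.exp_le_exp.2 (by linarith [neg_abs_le (N y), hC y]))
      (h0 y)
  have h1 : q x * Real.exp (-N x) ≤ 0 := hanti.ge_of_tendsto hl x
  exact le_antisymm (nonpos_of_mul_nonpos_left h1 (Real.exp_pos _)) (h0 x)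

/-- If `𝒥w = 0`, then `w' = u p` with `p' = Re(u w̄)`, so `|w|² - p²` is constant. As `w → 0` and `p
→ ±c` at the ends, the constant is `-c²`. If `c ≠ 0`, then `p` changes sign, and at a zero of `p`
one gets `|w|² = -c² < 0`. So `c = 0` and `|w| = |p|`; hence `(p²)' ≤ 2|u| p²` with `p → 0` at `-∞`,
which forces `p = 0`. -/
theorem opJ_injective (u : Sch) : Function.Injective (opJ u) := by
  refine (injective_iff_map_eq_zero _).2 fun w hw => ?_
  set p := dxInv (reMulConj u w) with hp
  have hpd : ∀ x, HasDerivAt p (reMulConj u w x) x := hasDerivAt_dxInv _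
  have hwd : ∀ x, deriv w x = u x * (p x : ℂ) := fun x => by
    have h1 : quadOp LinearMap.id u w x = 0 := by
      rw [← opJ_eq_quadOp, hw]
      rfl
    rw [quadOp_apply] at h1
    exact sub_eq_zero.1 h1
  have hre : ∀ x, HasDerivAt (fun y => (w y).re) ((u x).re * p x) x := fun x => by
    have h := Complex.reCLM.hasFDerivAt.comp_hasDerivAt x (w.hasDerivAt x)
    rw [hwd] at h
    simpa [Function.comp_def] using h
  have him : ∀ x, HasDerivAt (fun y => (w y).im) ((u x).im * p x) x := fun x => by
    have h := Complex.imCLM.hasFDerivAt.comp_hasDerivAt x (w.hasDerivAt x)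
    rw [hwd] at h
    simpa [Function.comp_def] using h
  have hlim : ∀ l : Filter ℝ, Tendsto w l (𝓝 0) →
      Tendsto (fun y => (w y).re ^ 2 + (w y).im ^ 2) l (𝓝 0) := fun l hl => by
    have h1 := ((Complex.continuous_re.tendsto 0).comp hl).pow 2
    have h2 := ((Complex.continuous_im.tendsto 0).comp hl).pow 2
    simpa [Function.comp_def] using h1.add h2
  set c := (∫ y, reMulConj u w y) / 2
  have htop : Tendsto p atTop (𝓝 c) := tendsto_dxInv_atTop _
  have hbot : Tendsto p atBot (𝓝 (-c)) := tendsto_dxInv_atBot _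
  have hE : ∀ x, (w x).re ^ 2 + (w x).im ^ 2 - p x ^ 2 = -c ^ 2 := by
    have hd : ∀ x, HasDerivAt (fun y => (w y).re ^ 2 + (w y).im ^ 2 - p y ^ 2) 0 x := fun x => by
      have h := (((hre x).pow 2).add ((him x).pow 2)).sub ((hpd x).pow 2)
      refine h.congr_deriv ?_
      rw [reMulConj_apply]
      push_cast
      ring
    have hconst := is_const_of_deriv_eq_zero (fun x => (hd x).differentiableAt) fun x => (hd x).deriv
    intro x
    have h1 : Tendsto (fun y => (w y).re ^ 2 + (w y).im ^ 2 - p y ^ 2) atTop (𝓝 (0 - c ^ 2)) :=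
      (hlim _ (tendsto_atTop_schwartz w)).sub (htop.pow 2)
    rw [funext fun y => hconst y x, tendsto_const_nhds_iff] at h1
    rw [h1, zero_sub]
  have hc : c = 0 := by
    by_contra hne
    have h1 : Tendsto (fun x => p x * p (-x)) atTop (𝓝 (c * -c)) :=
      htop.mul (hbot.comp tendsto_neg_atTop_atBot)
    have h2 : c * -c < 0 := by
      have := mul_self_pos.2 hne
      linarith
    obtain ⟨x, hx⟩ := (h1.eventually (gt_mem_nhds h2)).exists
    have hcont : Continuous p := continuous_iff_continuousAt.2 fun y => (hpd y).continuousAt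
    obtain ⟨y, hy⟩ : (0 : ℝ) ∈ range p := by
      rcases mul_neg_iff.1 hx with ⟨ha, hb⟩ | ⟨ha, hb⟩
      · exact mem_range_of_exists_le_of_exists_ge hcont ⟨_, hb.le⟩ ⟨_, ha.le⟩
      · exact mem_range_of_exists_le_of_exists_ge hcont ⟨_, ha.le⟩ ⟨_, hb.le⟩
    have h3 := hE y
    rw [hy] at h3
    have h4 : 0 < c ^ 2 := by positivity
    nlinarith [sq_nonneg (w y).re, sq_nonneg (w y).im]
  have hnorm : ∀ x, ‖w x‖ = |p x| := fun x => by
    rw [← sq_eq_sq₀ (norm_nonneg _) (abs_nonneg _), sq_abs, ← Complex.normSq_eq_norm_sq,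
      Complex.normSq_apply]
    have h1 := hE x
    rw [hc] at h1
    linarith
  have hu : Integrable fun x => 2 * ‖u x‖ := u.integrable.norm.const_mul 2
  have hp0 : ∀ x, p x ^ 2 = 0 := eq_zero_of_hasDerivAt_le (q := fun x => p x ^ 2)
    (q' := fun x => 2 * p x * reMulConj u w x) (N := fun x => ∫ y in (0 : ℝ)..x, 2 * ‖u y‖)
    (n := fun x => 2 * ‖u x‖) (C := ∫ y, 2 * ‖u y‖)
    (fun x => by simpa using (hpd x).fun_pow 2)
    (fun x => by
      have hcu : Continuous fun x => 2 * ‖u x‖ := continuous_const.mul u.continuous.norm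
      exact intervalIntegral.integral_hasDerivAt_right (hcu.intervalIntegrable _ _)
        hcu.stronglyMeasurable.stronglyMeasurableAtFilter hcu.continuousAt)
    (fun x => sq_nonneg _)
    (fun x => by
      have h1 : |reMulConj u w x| ≤ ‖u x‖ * ‖w x‖ := by
        have h2 : reMulConj u w x = (u x * starRingEnd ℂ (w x)).re := rfl
        rw [h2]
        refine (Complex.abs_re_le_norm _).trans ?_
        rw [norm_mul, Complex.norm_conj]
      rw [hnorm] at h1
      have h3 : p x * reMulConj u w x ≤ |p x| * (‖u x‖ * |p x|) :=
        (le_abs_self _).trans ((abs_mul _ _).trans_le (mul_le_mul_of_nonneg_left h1 (abs_nonneg _)))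
      have h4 : |p x| * (‖u x‖ * |p x|) = ‖u x‖ * p x ^ 2 := by
        rw [← sq_abs (p x)]
        ring
      linarith)
    (fun x => by
      rw [← Real.norm_eq_abs]
      refine intervalIntegral.norm_integral_le_integral_norm_uIoc.trans ?_
      have h1 : ∀ y, ‖2 * ‖u y‖‖ = 2 * ‖u y‖ := fun y => Real.norm_of_nonneg (by positivity)
      simp only [h1]
      exact setIntegral_le_integral hu (.of_forall fun y => by positivity))
    (by
      rw [hc, neg_zero] at hbot
      simpa using hbot.pow 2)
  ext x
  have h1 := hnorm x
  rw [pow_eq_zero_iff two_ne_zero |>.1 (hp0 x), abs_zero, norm_eq_zero] at h1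
  exact h1

/-! ### Invariance under phase rotations -/

theorem isU1Invariant_quadOp {L : Sch →ₗ[ℝ] Sch} (hL : ∀ (c : ℂ) (u : Sch), L (c • u) = c • L u) :
    IsU1Invariant (quadOp L) := by
  intro φ u f
  have he : Complex.exp (φ * Complex.I) * starRingEnd ℂ (Complex.exp (φ * Complex.I)) = 1 := by
    rw [Complex.mul_conj, Complex.normSq_eq_norm_sq, Complex.norm_exp_ofReal_mul_I]
    simp
  have h : reMulConj (Complex.exp (φ * Complex.I) • L u) (Complex.exp (φ * Complex.I) • f) =
      reMulConj (L u) f := by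
    ext x
    change (Complex.exp (φ * Complex.I) * L u x *
      starRingEnd ℂ (Complex.exp (φ * Complex.I) * f x)).re = (L u x * starRingEnd ℂ (f x)).re
    rw [map_mul, mul_mul_mul_comm, he, one_mul]
  ext x
  rw [quadOp_apply, hL, h]
  change opD (opMul (Complex.exp (φ * Complex.I)) f) x - _ = _ * quadOp L u f x
  rw [opD_opMul, opMul_apply, quadOp_apply, smul_apply, smul_eq_mul]
  ring

theorem opMul_smul (a c : ℂ) (u : Sch) : opMul a (c • u) = c • opMul a u := by
  ext x
  change a * (c * u x) = c * (a * u x)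
  ring

theorem isU1Invariant_opH : IsU1Invariant opH := by
  rw [funext opH_eq_quadOp]
  exact isU1Invariant_quadOp (opMul_smul Complex.I)

theorem isU1Invariant_opJ : IsU1Invariant opJ :=
  isU1Invariant_quadOp (L := LinearMap.id) fun _ _ => rfl

theorem isU1Invariant_opR : IsU1Invariant opR := fun φ u f => by
  have h : ∀ u f, opR u f = opMul Complex.I (opJ u f) := fun _ _ => rfl
  rw [h, h, isU1Invariant_opJ φ u f]
  exact opMul_smul _ _ _

/-! ### Factorisations of `ℛ` -/

theorem opI_symm_apply (f : Sch) (x : ℝ) : opI.symm f x = Complex.I * f x := by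
  have h : opI (opMul Complex.I f) = f := by
    ext x
    rw [opI_apply, opMul_apply, ← mul_assoc]
    simp
  rw [← LinearEquiv.eq_symm_apply] at h
  rw [← h, opMul_apply]

theorem opI_symm_eq (f : Sch) : opI.symm f = opMul Complex.I f := by
  ext x
  rw [opI_symm_apply, opMul_apply]

theorem neg_opI_eq (f : Sch) : -opI f = opMul Complex.I f := by
  ext x
  rw [neg_apply, opI_apply, opMul_apply]
  ring

/-- Rotating both arguments by `i` leaves `Re(u f̄)` unchanged, so `i` can be pulled out of `ℋ(i
f)`. -/
theorem opR_eq_opH_symm (u f : Sch) : opR u f = opH u (opI.symm f) := by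
  have h : reMulConj (opMul Complex.I u) (opMul Complex.I f) = reMulConj u f := by
    ext x
    simp only [reMulConj_apply, opMul_apply, Complex.mul_re, Complex.mul_im, Complex.I_re,
      Complex.I_im]
    ring
  ext x
  rw [opI_symm_eq, opH_eq_quadOp, quadOp_apply, h, opD_opMul]
  change Complex.I * quadOp LinearMap.id u f x = _
  rw [quadOp_apply, opMul_apply, opMul_apply, LinearMap.id_apply]
  ring

theorem opR_eq_neg_opI_opJ (u f : Sch) : opR u f = -opI (opJ u f) := by
  rw [neg_opI_eq]
  rfl

theorem opH_opI_symm (u f : Sch) : opH u (opI.symm f) = -opI (opJ u f) := by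
  rw [← opR_eq_opH_symm, opR_eq_neg_opI_opJ]

theorem opJ_opI (u f : Sch) : opJ u (opI f) = -opI.symm (opH u f) := by
  have h := opH_opI_symm u (opI f)
  rw [LinearEquiv.symm_apply_apply] at h
  rw [h, map_neg, LinearEquiv.symm_apply_apply, neg_neg]

/-! ### The recursion operator `ℛ` -/

theorem opR_apply_eq (u f : Sch) : opR u f = opMul Complex.I (quadOp LinearMap.id u f) := rfl

/-- The derivative of `ℛ` with respect to `u` in the direction `v`. -/
def opRDeriv (u v : Sch) : Sch →ₗ[ℝ] Sch := opMul Complex.I ∘ₗ quadOpDeriv LinearMap.id u v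

theorem hasDerivAt_opR (u v : Sch) {c : ℝ → Sch} {c' : Sch} (hc : HasDerivAt c c' 0) :
    HasDerivAt (fun s : ℝ => opR (u + s • v) (c s)) (opR u c' + opRDeriv u v (c 0)) 0 := by
  have h := hasDerivAt_clm_comp_tvs (continuous_opMul Complex.I)
    (hasDerivAt_quadOp LinearMap.id u v hc)
  rwa [map_add] at h

theorem hasDerivAt_opR_const (u v g : Sch) :
    HasDerivAt (fun s : ℝ => opR (u + s • v) g) (opRDeriv u v g) 0 := by
  have hc : HasDerivAt (fun _ : ℝ => g) 0 0 := by
    rw [hasDerivAt_zero_iff]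
    simp
  simpa using hasDerivAt_opR u v hc

theorem opRDeriv_apply (u v g : Sch) (x : ℝ) : opRDeriv u v g x =
    -Complex.I * (u x * (dxInv (reMulConj v g) x : ℂ) + v x * (dxInv (reMulConj u g) x : ℂ)) := by
  rw [← nonlocal_apply, ← nonlocal_apply]
  change Complex.I * -(nonlocal u v g x + nonlocal v u g x) = _
  ring

/-- Let `Z = ℛ'[f]g - ℛ'[g]f`; its terms with `D_x⁻¹ Re(f ḡ)` cancel by symmetry. The key is that
`Re((ℛf) ḡ) - Re((ℛg) f̄) - Re(u Z̄)` is the derivative of `Re(i f ḡ)`, so `D_x⁻¹` of it is local.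
The rest is pointwise algebra. -/
theorem opR_hereditary (u f g : Sch) :
    opRDeriv u (opR u f) g - opRDeriv u (opR u g) f =
      opR u (opRDeriv u f g - opRDeriv u g f) := by
  have hZ : opRDeriv u f g - opRDeriv u g f =
      -opMul Complex.I (mulDxInv f (reMulConj u g) - mulDxInv g (reMulConj u f)) := by
    ext x
    rw [sub_apply, neg_apply, opMul_apply, sub_apply, opRDeriv_apply, opRDeriv_apply,
      mulDxInv_apply, mulDxInv_apply, reMulConj_comm f g]
    ring
  rw [hZ]
  set Z := -opMul Complex.I (mulDxInv f (reMulConj u g) - mulDxInv g (reMulConj u f)) with hZ'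
  have hD : ∀ x, HasDerivAt (reMulConj (opMul Complex.I f) g)
      (SchwartzMap.derivCLM ℝ ℝ (reMulConj (opMul Complex.I f) g) x) x := fun x =>
    (reMulConj (opMul Complex.I f) g).hasDerivAt x
  have hD' : ∀ x, SchwartzMap.derivCLM ℝ ℝ (reMulConj (opMul Complex.I f) g) x =
      reMulConj (opMul Complex.I (opD f)) g x + reMulConj (opMul Complex.I f) (opD g) x := by
    intro x
    refine (hD x).unique ?_
    have h1 := Complex.reCLM.hasFDerivAt.comp_hasDerivAt x
      ((mulConj (opMul Complex.I f) g).hasDerivAt x)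
    refine h1.congr_deriv ?_
    rw [← opD_apply, opD_mulConj_apply, opD_opMul]
    rfl
  have hS : reMulConj (opR u f) g = reMulConj (opR u g) f + reMulConj u Z +
      SchwartzMap.derivCLM ℝ ℝ (reMulConj (opMul Complex.I f) g) := by
    ext x
    rw [add_apply, add_apply, hD']
    simp [reMulConj_apply, opR_apply_eq, opMul_apply, quadOp_apply, mulDxInv_apply, hZ']
    ring
  have hP : ∀ x, dxInv (reMulConj (opR u f) g) x = dxInv (reMulConj (opR u g) f) x +
      dxInv (reMulConj u Z) x + reMulConj (opMul Complex.I f) g x := by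
    intro x
    rw [hS, dxInv_add, dxInv_add, dxInv_eq_of_deriv hD]
    rfl
  ext x
  have hDZ : opD Z x = -Complex.I * ((opD f x * (dxInv (reMulConj u g) x : ℂ) +
      f x * (reMulConj u g x : ℂ)) - (opD g x * (dxInv (reMulConj u f) x : ℂ) +
      g x * (reMulConj u f x : ℂ))) := by
    rw [hZ', map_neg, neg_apply, opD_opMul, opMul_apply, map_sub, sub_apply, opD_mulDxInv_apply,
      opD_mulDxInv_apply]
    ring
  rw [sub_apply, opRDeriv_apply, opRDeriv_apply, hP, opR_apply_eq u Z, opMul_apply, quadOp_apply,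
    hDZ, LinearMap.id_apply]
  apply Complex.ext
  · simp [reMulConj_apply, opR_apply_eq, opMul_apply, quadOp_apply]
    ring
  · simp [reMulConj_apply, opR_apply_eq, opMul_apply, quadOp_apply]
    ring

theorem isHereditary_opR : IsHereditary opR :=
  ⟨fun u v g => opRDeriv u v g, hasDerivAt_opR_const, opR_hereditary⟩

/-- The infinitesimal form of phase invariance, and the case `n = 0` of the recursion property. -/
theorem opRDeriv_opI (u g : Sch) : opRDeriv u (opI u) g = opI (opR u g) - opR u (opI g) := by
  have h : mulDxInv u (reMulConj u (opI g)) = -mulDxInv u (reMulConj (opI u) g) := by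
    rw [← map_neg]
    congr 1
    ext x
    rw [neg_apply]
    simp [reMulConj_apply, opI_apply]
  have hx := fun x => congrArg (fun f : Sch => f x) h
  simp only [neg_apply, mulDxInv_apply] at hx
  ext x
  have h1 : opD (opI g) x = -Complex.I * opD g x := by
    change opD (opMul (-Complex.I) g) x = _
    rw [opD_opMul, opMul_apply]
  have h2 : opI (opR u g) x = -Complex.I * (Complex.I * quadOp LinearMap.id u g x) := rfl
  have h3 : opR u (opI g) x = Complex.I * quadOp LinearMap.id u (opI g) x := rfl
  rw [opRDeriv_apply, sub_apply, h2, h3, quadOp_apply, quadOp_apply, LinearMap.id_apply, hx, h1,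
    opI_apply]
  ring

theorem opR_recursion (n : ℕ) : ∃ dX : Sch → Sch → Sch,
    (∀ u g : Sch, HasDerivAt (fun s : ℝ => (opR (u + s • g) ^ n) (opI (u + s • g))) (dX u g) 0) ∧
    ∀ u g : Sch, opRDeriv u ((opR u ^ n) (opI u)) g = dX u (opR u g) - opR u (dX u g) := by
  induction n with
  | zero =>
    exact ⟨fun _ g => opI g, fun u g => hasDerivAt_clm_comp_tvs (L := opI.toLinearMap)
      continuous_opI (hasDerivAt_line u g),
      opRDeriv_opI⟩
  | succ n ih =>
    obtain ⟨dX, hd, hX⟩ := ih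
    -- This is the product rule for `ℛX`. Heredity with `f = X` then turns the recursion property of
    -- `X` into that of `ℛX`.
    refine ⟨fun u g => opR u (dX u g) + opRDeriv u g ((opR u ^ n) (opI u)), fun u g => ?_,
      fun u g => ?_⟩
    · have h := hasDerivAt_opR u g (hd u g)
      simp only [zero_smul, add_zero] at h
      simpa only [pow_succ', Module.End.mul_apply] using h
    · rw [pow_succ', Module.End.mul_apply]
      have h1 := opR_hereditary u ((opR u ^ n) (opI u)) g
      rw [map_sub, hX, map_sub] at h1
      rw [sub_eq_iff_eq_add] at h1
      rw [h1, map_add]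
      module

theorem isRecursionOperator_opR (n : ℕ) :
    IsRecursionOperator opR fun u => (opR u ^ n) (opI u) := by
  obtain ⟨dX, hd, hX⟩ := opR_recursion n
  exact ⟨fun u v g => opRDeriv u v g, dX, hasDerivAt_opR_const, hd, hX⟩

/-! ### Structure equations of an inelastic timelike flow -/

section Calculus

variable {T X : Set ℝ} {f g : ℝ → ℝ → Mink} {t x : ℝ}

theorem hasDerivAt_comp_fst {E : Type*} [NormedAddCommGroup E] [NormedSpace ℝ E] {G : ℝ × ℝ → E}
    {G' : ℝ × ℝ →L[ℝ] E} (h : HasFDerivAt G G' (t, x)) :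
    HasDerivAt (fun s => G (s, x)) (G' (1, 0)) t :=
  HasFDerivAt.comp_hasDerivAt (f := fun s => (s, x)) t h
    ((hasDerivAt_id' t).prodMk (hasDerivAt_const t x))

theorem hasDerivAt_comp_snd {E : Type*} [NormedAddCommGroup E] [NormedSpace ℝ E] {G : ℝ × ℝ → E}
    {G' : ℝ × ℝ →L[ℝ] E} (h : HasFDerivAt G G' (t, x)) :
    HasDerivAt (fun y => G (t, y)) (G' (0, 1)) x :=
  HasFDerivAt.comp_hasDerivAt (f := fun y => (t, y)) x h
    ((hasDerivAt_const x t).prodMk (hasDerivAt_id' x))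

theorem SmoothOn.contDiffAt (hT : IsOpen T) (hX : IsOpen X) (hf : SmoothOn T X f) (ht : t ∈ T)
    (hx : x ∈ X) : ContDiffAt ℝ ∞ (fun p : ℝ × ℝ => f p.1 p.2) (t, x) :=
  ContDiffOn.contDiffAt hf ((hT.prod hX).mem_nhds ⟨ht, hx⟩)

theorem SmoothOn.hasFDerivAt (hT : IsOpen T) (hX : IsOpen X) (hf : SmoothOn T X f) (ht : t ∈ T)
    (hx : x ∈ X) : HasFDerivAt (fun p : ℝ × ℝ => f p.1 p.2)
      (fderiv ℝ (fun p : ℝ × ℝ => f p.1 p.2) (t, x)) (t, x) :=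
  ((hf.contDiffAt hT hX ht hx).differentiableAt (by simp)).hasFDerivAt

theorem SmoothOn.hasDerivAt_fderiv_snd (hT : IsOpen T) (hX : IsOpen X) (hf : SmoothOn T X f)
    (ht : t ∈ T) (hx : x ∈ X) :
    HasDerivAt (fun y => f t y) (fderiv ℝ (fun p : ℝ × ℝ => f p.1 p.2) (t, x) (0, 1)) x :=
  hasDerivAt_comp_snd (hf.hasFDerivAt hT hX ht hx)

theorem SmoothOn.hasDerivAt_fderiv_fst (hT : IsOpen T) (hX : IsOpen X) (hf : SmoothOn T X f)
    (ht : t ∈ T) (hx : x ∈ X) :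
    HasDerivAt (fun s => f s x) (fderiv ℝ (fun p : ℝ × ℝ => f p.1 p.2) (t, x) (1, 0)) t :=
  hasDerivAt_comp_fst (hf.hasFDerivAt hT hX ht hx)

theorem SmoothOn.hasDerivAt_dx (hT : IsOpen T) (hX : IsOpen X) (hf : SmoothOn T X f)
    (ht : t ∈ T) (hx : x ∈ X) : HasDerivAt (fun y => f t y) (dx f t x) x :=
  (hf.hasDerivAt_fderiv_snd hT hX ht hx).differentiableAt.hasDerivAt

theorem SmoothOn.hasDerivAt_dt (hT : IsOpen T) (hX : IsOpen X) (hf : SmoothOn T X f)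
    (ht : t ∈ T) (hx : x ∈ X) : HasDerivAt (fun s => f s x) (dt f t x) t :=
  (hf.hasDerivAt_fderiv_fst hT hX ht hx).differentiableAt.hasDerivAt

theorem SmoothOn.fderiv_contDiffOn (hT : IsOpen T) (hX : IsOpen X) (hf : SmoothOn T X f) :
    ContDiffOn ℝ ∞ (fderiv ℝ fun p : ℝ × ℝ => f p.1 p.2) (T ×ˢ X) :=
  ContDiffOn.fderiv_of_isOpen hf (hT.prod hX) (by simp)

theorem SmoothOn.dx (hT : IsOpen T) (hX : IsOpen X) (hf : SmoothOn T X f) :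
    SmoothOn T X (dx f) :=
  ((hf.fderiv_contDiffOn hT hX).clm_apply contDiffOn_const).congr fun _ hp =>
    (hf.hasDerivAt_fderiv_snd hT hX hp.1 hp.2).deriv

theorem SmoothOn.dt (hT : IsOpen T) (hX : IsOpen X) (hf : SmoothOn T X f) :
    SmoothOn T X (dt f) :=
  ((hf.fderiv_contDiffOn hT hX).clm_apply contDiffOn_const).congr fun _ hp =>
    (hf.hasDerivAt_fderiv_fst hT hX hp.1 hp.2).deriv

theorem SmoothOn.dt_dx_comm (hT : IsOpen T) (hX : IsOpen X) (hf : SmoothOn T X f)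
    (ht : t ∈ T) (hx : x ∈ X) :
    HasimotoFlow.dt (HasimotoFlow.dx f) t x = HasimotoFlow.dx (HasimotoFlow.dt f) t x := by
  set F := fun p : ℝ × ℝ => f p.1 p.2 with hF
  have hev : ∀ᶠ p in 𝓝 (t, x), p ∈ T ×ˢ X := (hT.prod hX).mem_nhds ⟨ht, hx⟩
  have hd2 : HasFDerivAt (fderiv ℝ F) (fderiv ℝ (fderiv ℝ F) (t, x)) (t, x) :=
    (((hf.fderiv_contDiffOn hT hX).contDiffAt hev).differentiableAt (by simp)).hasFDerivAt
  have hsymm := second_derivative_symmetric_of_eventually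
    (hev.mono fun p hp => hf.hasFDerivAt hT hX hp.1 hp.2) hd2 (1, 0) (0, 1)
  have h1 : HasDerivAt (fun s => HasimotoFlow.dx f s x)
      (fderiv ℝ (fderiv ℝ F) (t, x) (1, 0) (0, 1)) t := by
    have h := (ContinuousLinearMap.apply ℝ Mink ((0, 1) : ℝ × ℝ)).hasFDerivAt.comp_hasDerivAt t
      (hasDerivAt_comp_fst hd2)
    refine h.congr_of_eventuallyEq ?_
    filter_upwards [hT.mem_nhds ht] with s hs
    exact (hf.hasDerivAt_fderiv_snd hT hX hs hx).deriv
  have h2 : HasDerivAt (fun y => HasimotoFlow.dt f t y)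
      (fderiv ℝ (fderiv ℝ F) (t, x) (0, 1) (1, 0)) x := by
    have h := (ContinuousLinearMap.apply ℝ Mink ((1, 0) : ℝ × ℝ)).hasFDerivAt.comp_hasDerivAt x
      (hasDerivAt_comp_snd hd2)
    refine h.congr_of_eventuallyEq ?_
    filter_upwards [hX.mem_nhds hx] with y hy
    exact (hf.hasDerivAt_fderiv_fst hT hX ht hy).deriv
  exact h1.deriv.trans (hsymm.trans h2.deriv.symm)

theorem hasDerivAt_eta {a b : ℝ → Mink} {a' b' : Mink} {s : ℝ} (ha : HasDerivAt a a' s)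
    (hb : HasDerivAt b b' s) :
    HasDerivAt (fun r => eta (a r) (b r)) (eta a' (b s) + eta (a s) b') s := by
  have ha' := hasDerivAt_pi.1 ha
  have hb' := hasDerivAt_pi.1 hb
  refine ((((ha' 0).mul (hb' 0)).neg.add ((ha' 1).mul (hb' 1))).add
    ((ha' 2).mul (hb' 2))).congr_deriv ?_
  simp only [eta]
  ring

theorem eta_comm (v w : Mink) : eta v w = eta w v := by
  simp only [eta]
  ring

theorem eta_smul_right (c : ℝ) (v w : Mink) : eta v (c • w) = c * eta v w := by
  simp only [eta, Pi.smul_apply, smul_eq_mul]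
  ring

theorem eta_dx_of_const (hT : IsOpen T) (hX : IsOpen X) (hf : SmoothOn T X f)
    (hg : SmoothOn T X g) {c : ℝ} (h : ∀ t ∈ T, ∀ x ∈ X, eta (f t x) (g t x) = c) (ht : t ∈ T)
    (hx : x ∈ X) : eta (dx f t x) (g t x) + eta (f t x) (dx g t x) = 0 := by
  have h1 := hasDerivAt_eta (hf.hasDerivAt_dx hT hX ht hx) (hg.hasDerivAt_dx hT hX ht hx)
  refine h1.unique ((hasDerivAt_const x c).congr_of_eventuallyEq ?_)
  filter_upwards [hX.mem_nhds hx] with y hy using h t ht y hy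

theorem eta_dt_of_const (hT : IsOpen T) (hX : IsOpen X) (hf : SmoothOn T X f)
    (hg : SmoothOn T X g) {c : ℝ} (h : ∀ t ∈ T, ∀ x ∈ X, eta (f t x) (g t x) = c) (ht : t ∈ T)
    (hx : x ∈ X) : eta (dt f t x) (g t x) + eta (f t x) (dt g t x) = 0 := by
  have h1 := hasDerivAt_eta (hf.hasDerivAt_dt hT hX ht hx) (hg.hasDerivAt_dt hT hX ht hx)
  refine h1.unique ((hasDerivAt_const t c).congr_of_eventuallyEq ?_)
  filter_upwards [hT.mem_nhds ht] with s hs using h s hs x hx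

theorem hasDerivAt_perp {a b c : ℝ → Mink} {a' b' c' : Mink} {s : ℝ} (ha : HasDerivAt a a' s)
    (hb : HasDerivAt b b' s) (hc : HasDerivAt c c' s) :
    HasDerivAt (fun r => perp (a r) (b r) (c r))
      (((eta a' (b s) + eta (a s) b' : ℝ) : ℂ) +
        Complex.I * ((eta a' (c s) + eta (a s) c' : ℝ) : ℂ)) s :=
  (hasDerivAt_eta ha hb).ofReal_comp.add ((hasDerivAt_eta ha hc).ofReal_comp.const_mul Complex.I)

end Calculus

/-- The expansion of the Minkowski metric in an orthonormal frame. -/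
theorem eta_eq_of_orthonormal {a b c : Mink} (haa : eta a a = -1) (hbb : eta b b = 1)
    (hcc : eta c c = 1) (hab : eta a b = 0) (hac : eta a c = 0) (hbc : eta b c = 0) (v w : Mink) :
    eta v w = -(eta v a * eta w a) + eta v b * eta w b + eta v c * eta w c := by
  have h : (Matrix.of ![a, b, c] : Matrix (Fin 3) (Fin 3) ℝ) *
      Matrix.of ![![a 0, -b 0, -c 0], ![-a 1, b 1, c 1], ![-a 2, b 2, c 2]] = 1 := by
    ext i j
    simp only [eta] at haa hbb hcc hab hac hbc
    fin_cases i <;> fin_cases j <;> simp [Matrix.mul_apply, Fin.sum_univ_three] <;> linarith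
  -- Orthonormality says that the second matrix is a right inverse of the frame matrix; being also a
  -- left inverse, it yields the completeness relation.
  rw [mul_eq_one_comm] at h
  have hij := fun i j => congrFun (congrFun h i) j
  have h00 := hij 0 0
  have h01 := hij 0 1
  have h02 := hij 0 2
  have h11 := hij 1 1
  have h12 := hij 1 2
  have h22 := hij 2 2
  simp [Matrix.mul_apply, Fin.sum_univ_three] at h00 h01 h02 h11 h12 h22
  simp only [eta]
  linear_combination v 0 * w 0 * h00 - (v 0 * w 1 + v 1 * w 0) * h01 -
    (v 0 * w 2 + v 2 * w 0) * h02 - v 1 * w 1 * h11 - (v 1 * w 2 + v 2 * w 1) * h12 -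
    v 2 * w 2 * h22

section Flow

variable {T X : Set ℝ} {γ e₁ e₂ : ℝ → ℝ → Mink} {t x : ℝ}

/-- The orthogonality and structure equations of the frame at a point. -/
theorem frame_equations (hT : IsOpen T) (hX : IsOpen X) (hγ : IsInelasticTimelikeFlow T X γ)
    (he : IsParallelFrame T X γ e₁ e₂) (ht : t ∈ T) (hx : x ∈ X) :
    dx e₁ t x = eta (dx (dx γ) t x) (e₁ t x) • dx γ t x ∧
    dx e₂ t x = eta (dx (dx γ) t x) (e₂ t x) • dx γ t x ∧
    eta (dx (dx γ) t x) (dx γ t x) = 0 ∧ eta (dt (dx γ) t x) (dx γ t x) = 0 ∧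
    eta (dt e₁ t x) (e₁ t x) = 0 ∧ eta (dt e₂ t x) (e₂ t x) = 0 ∧
    eta (dt e₂ t x) (e₁ t x) = -omegaZero e₁ e₂ t x ∧
    eta (dt e₁ t x) (dx γ t x) = -eta (dt (dx γ) t x) (e₁ t x) ∧
    eta (dt e₂ t x) (dx γ t x) = -eta (dt (dx γ) t x) (e₂ t x) := by
  have h0 := hγ.smooth.dx hT hX
  have h1 := he.smooth₁
  have h2 := he.smooth₂
  have hpar : ∀ {e : ℝ → ℝ → Mink}, SmoothOn T X e →
      (∀ t ∈ T, ∀ x ∈ X, eta (dx γ t x) (e t x) = 0) →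
      (∃ a : ℝ, dx e t x = a • dx γ t x) →
      dx e t x = eta (dx (dx γ) t x) (e t x) • dx γ t x := by
    rintro e hs ho ⟨a, ha⟩
    have h3 := eta_dx_of_const hT hX h0 hs ho ht hx
    rw [ha, eta_smul_right, hγ.unit t ht x hx] at h3
    rw [ha]
    congr 1
    linarith
  refine ⟨hpar h1 he.orth₀₁ (he.parallel₁ t ht x hx), hpar h2 he.orth₀₂ (he.parallel₂ t ht x hx),
    ?_, ?_, ?_, ?_, ?_, ?_, ?_⟩
  · have h := eta_dx_of_const hT hX h0 h0 hγ.unit ht hx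
    rw [eta_comm (dx γ t x)] at h
    linarith
  · have h := eta_dt_of_const hT hX h0 h0 hγ.unit ht hx
    rw [eta_comm (dx γ t x)] at h
    linarith
  · have h := eta_dt_of_const hT hX h1 h1 he.unit₁ ht hx
    rw [eta_comm (e₁ t x)] at h
    linarith
  · have h := eta_dt_of_const hT hX h2 h2 he.unit₂ ht hx
    rw [eta_comm (e₂ t x)] at h
    linarith
  · have h := eta_dt_of_const hT hX h1 h2 he.orth₁₂ ht hx
    rw [eta_comm (e₁ t x)] at h
    unfold omegaZero
    linarith
  · have h := eta_dt_of_const hT hX h0 h1 he.orth₀₁ ht hx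
    rw [eta_comm (dx γ t x)] at h
    linarith
  · have h := eta_dt_of_const hT hX h0 h2 he.orth₀₂ ht hx
    rw [eta_comm (dx γ t x)] at h
    linarith

theorem frame_expansion (hγ : IsInelasticTimelikeFlow T X γ)
    (he : IsParallelFrame T X γ e₁ e₂) (ht : t ∈ T) (hx : x ∈ X) (v w : Mink) :
    eta v w = -(eta v (dx γ t x) * eta w (dx γ t x)) + eta v (e₁ t x) * eta w (e₁ t x) +
      eta v (e₂ t x) * eta w (e₂ t x) :=
  eta_eq_of_orthonormal (hγ.unit t ht x hx) (he.unit₁ t ht x hx) (he.unit₂ t ht x hx)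
    (he.orth₀₁ t ht x hx) (he.orth₀₂ t ht x hx) (he.orth₁₂ t ht x hx) v w

/-- `u_t = ω_x - i ω₀ u`. -/
theorem deriv_uVar (hT : IsOpen T) (hX : IsOpen X) (hγ : IsInelasticTimelikeFlow T X γ)
    (he : IsParallelFrame T X γ e₁ e₂) (ht : t ∈ T) (hx : x ∈ X) :
    deriv (fun s => uVar γ e₁ e₂ s x) t = deriv (omegaVar γ e₁ e₂ t) x -
      Complex.I * uVar γ e₁ e₂ t x * (omegaZero e₁ e₂ t x : ℂ) := by
  have h0 := hγ.smooth.dx hT hX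
  obtain ⟨f1, f2, f3, f4, f5, f6, f7, f8, f9⟩ := frame_equations hT hX hγ he ht hx
  have hu := hasDerivAt_perp ((h0.dx hT hX).hasDerivAt_dt hT hX ht hx)
    (he.smooth₁.hasDerivAt_dt hT hX ht hx) (he.smooth₂.hasDerivAt_dt hT hX ht hx)
  have hω := hasDerivAt_perp ((h0.dt hT hX).hasDerivAt_dx hT hX ht hx)
    (he.smooth₁.hasDerivAt_dx hT hX ht hx) (he.smooth₂.hasDerivAt_dx hT hX ht hx)
  have hu' : deriv (fun s => uVar γ e₁ e₂ s x) t = _ := hu.deriv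
  have hω' : deriv (omegaVar γ e₁ e₂ t) x = _ := hω.deriv
  -- In `ω_x` the terms `η((e₀)_t, (e_j)_x)` vanish, since `(e_j)_x` is parallel to `e₀` and
  -- `(e₀)_t` is orthogonal to it.
  rw [hu', hω', h0.dt_dx_comm hT hX ht hx, f1, f2, eta_smul_right, eta_smul_right, f4,
    frame_expansion hγ he ht hx _ (dt e₁ t x), frame_expansion hγ he ht hx _ (dt e₂ t x), f3, f5,
    f6, f7]
  simp only [uVar, perp, omegaZero]
  apply Complex.ext
  · simp
  · simp
    ring

/-- `(ω₀)_x = -Im(u ω̄)`. -/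
theorem hasDerivAt_omegaZero (hT : IsOpen T) (hX : IsOpen X) (hγ : IsInelasticTimelikeFlow T X γ)
    (he : IsParallelFrame T X γ e₁ e₂) (ht : t ∈ T) (hx : x ∈ X) :
    HasDerivAt (omegaZero e₁ e₂ t)
      (-(uVar γ e₁ e₂ t x * starRingEnd ℂ (omegaVar γ e₁ e₂ t x)).im) x := by
  obtain ⟨f1, f2, f3, f4, f5, f6, f7, f8, f9⟩ := frame_equations hT hX hγ he ht hx
  have h := hasDerivAt_eta ((he.smooth₁.dt hT hX).hasDerivAt_dx hT hX ht hx)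
    (he.smooth₂.hasDerivAt_dx hT hX ht hx)
  refine h.congr_deriv ?_
  -- In a parallel frame `η((e₁)_x, e₂) = 0` throughout; its `t`-derivative expresses `η((e₁)_{xt},
  -- e₂)` through first derivatives.
  have h1 := eta_dt_of_const hT hX (he.smooth₁.dx hT hX) he.smooth₂ (c := 0) (fun s hs y hy => by
    rw [(frame_equations hT hX hγ he hs hy).1, eta_comm, eta_smul_right, eta_comm (e₂ s y),
      he.orth₀₂ s hs y hy, mul_zero]) ht hx
  rw [f1, eta_comm (_ • _), eta_smul_right, f9] at h1
  rw [← he.smooth₁.dt_dx_comm hT hX ht hx, f2, eta_smul_right, f8]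
  simp [uVar, omegaVar, perp]
  linarith

/-- `ω = (h_⊥)_x + h_∥ u`. -/
theorem omegaVar_eq (hT : IsOpen T) (hX : IsOpen X) (hγ : IsInelasticTimelikeFlow T X γ)
    (he : IsParallelFrame T X γ e₁ e₂) (ht : t ∈ T) (hx : x ∈ X) :
    omegaVar γ e₁ e₂ t x = deriv (hPerp γ e₁ e₂ t) x + uVar γ e₁ e₂ t x * (hPar γ t x : ℂ) := by
  obtain ⟨f1, f2, f3, f4, f5, f6, f7, f8, f9⟩ := frame_equations hT hX hγ he ht hx
  have hh := hasDerivAt_perp ((hγ.smooth.dt hT hX).hasDerivAt_dx hT hX ht hx)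
    (he.smooth₁.hasDerivAt_dx hT hX ht hx) (he.smooth₂.hasDerivAt_dx hT hX ht hx)
  have hh' : deriv (hPerp γ e₁ e₂ t) x = _ := hh.deriv
  rw [hh', ← hγ.smooth.dt_dx_comm hT hX ht hx, f1, f2, eta_smul_right, eta_smul_right]
  simp only [omegaVar, uVar, perp, hPar]
  push_cast
  ring

/-- `(h_∥)_x = -Re(u h̄_⊥)`. -/
theorem hasDerivAt_hPar (hT : IsOpen T) (hX : IsOpen X) (hγ : IsInelasticTimelikeFlow T X γ)
    (he : IsParallelFrame T X γ e₁ e₂) (ht : t ∈ T) (hx : x ∈ X) :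
    HasDerivAt (hPar γ t)
      (-(uVar γ e₁ e₂ t x * starRingEnd ℂ (hPerp γ e₁ e₂ t x)).re) x := by
  obtain ⟨f1, f2, f3, f4, f5, f6, f7, f8, f9⟩ := frame_equations hT hX hγ he ht hx
  have h := (hasDerivAt_eta ((hγ.smooth.dt hT hX).hasDerivAt_dx hT hX ht hx)
    ((hγ.smooth.dx hT hX).hasDerivAt_dx hT hX ht hx)).neg
  refine h.congr_deriv ?_
  rw [← hγ.smooth.dt_dx_comm hT hX ht hx, f4, frame_expansion hγ he ht hx (dt γ t x), f3]
  simp [uVar, hPerp, perp]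
  ring

/-- The flow equations, with `D_x⁻¹` standing for an antiderivative. -/
theorem flow_equations (hT : IsOpen T) (hX : IsOpen X) (hγ : IsInelasticTimelikeFlow T X γ)
    (he : IsParallelFrame T X γ e₁ e₂) (ht : t ∈ T) :
    (fun x => deriv (fun s => uVar γ e₁ e₂ s x) t) ∈
      valH X (uVar γ e₁ e₂ t) (omegaVar γ e₁ e₂ t) ∧
    omegaVar γ e₁ e₂ t ∈ valJ X (uVar γ e₁ e₂ t) (hPerp γ e₁ e₂ t) ∧
    ∃ g ∈ valR X (uVar γ e₁ e₂ t) (hPerp γ e₁ e₂ t),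
      (fun x => -deriv (fun s => uVar γ e₁ e₂ s x) t) ∈ valR X (uVar γ e₁ e₂ t) g := by
  have hP : (fun x => -omegaZero e₁ e₂ t x) ∈ Antideriv X
      (fun y => (uVar γ e₁ e₂ t y * starRingEnd ℂ (omegaVar γ e₁ e₂ t y)).im) := fun x hx => by
    simpa using (hasDerivAt_omegaZero hT hX hγ he ht hx).fun_neg
  have hQ : (fun x => -hPar γ t x) ∈ Antideriv X
      (fun y => (uVar γ e₁ e₂ t y * starRingEnd ℂ (hPerp γ e₁ e₂ t y)).re) := fun x hx => by
    simpa using (hasDerivAt_hPar hT hX hγ he ht hx).fun_neg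
  have hJ : omegaVar γ e₁ e₂ t ∈ valJ X (uVar γ e₁ e₂ t) (hPerp γ e₁ e₂ t) :=
    ⟨_, hQ, fun x hx => by
      rw [omegaVar_eq hT hX hγ he ht hx]
      push_cast
      ring⟩
  -- The intermediate value is `ℛ h_⊥ = iω`. Since `Re(u · conj(iω)) = Im(u ω̄)`, the antiderivative
  -- `-ω₀` also serves in the second application of `ℛ`.
  refine ⟨⟨_, hP, fun x hx => ?_⟩, hJ, fun x => Complex.I * omegaVar γ e₁ e₂ t x,
    ⟨_, hJ, fun x _ => rfl⟩,
    fun x => deriv (fun y => Complex.I * omegaVar γ e₁ e₂ t y) x -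
      uVar γ e₁ e₂ t x * ((-omegaZero e₁ e₂ t x : ℝ) : ℂ),
    ⟨fun x => -omegaZero e₁ e₂ t x, fun x hx => ?_, fun x _ => rfl⟩, fun x hx => ?_⟩
  · simp only [deriv_uVar hT hX hγ he ht hx]
    push_cast
    ring
  · refine (hP x hx).congr_deriv ?_
    simp
    ring
  · simp only [deriv_uVar hT hX hγ he ht hx, deriv_const_mul_field]
    push_cast
    linear_combination (-deriv (omegaVar γ e₁ e₂ t) x) * Complex.I_mul_I

/-- The flow equations for infinite curves with rapidly decreasing `u` and `h_⊥`. -/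
theorem flow_equations_schwartz (hT : IsOpen T) (hγ : IsInelasticTimelikeFlow T univ γ)
    (he : IsParallelFrame T univ γ e₁ e₂) {U h : Sch} (ht : t ∈ T)
    (hU : ∀ x, U x = uVar γ e₁ e₂ t x) (hh : ∀ x, h x = hPerp γ e₁ e₂ t x)
    (hpar : Tendsto (fun x => hPar γ t x + hPar γ t (-x)) atTop (𝓝 0))
    (hzero : Tendsto (fun x => omegaZero e₁ e₂ t x + omegaZero e₁ e₂ t (-x)) atTop (𝓝 0)) :
    (∀ x, opJ U h x = omegaVar γ e₁ e₂ t x) ∧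
    ∀ x, deriv (fun s => uVar γ e₁ e₂ s x) t = opH U (opJ U h) x := by
  have hU' : (U : ℝ → ℂ) = uVar γ e₁ e₂ t := funext hU
  have hh' : (h : ℝ → ℂ) = hPerp γ e₁ e₂ t := funext hh
  have hneg : ∀ {f : ℝ → ℝ}, Tendsto (fun x => f x + f (-x)) atTop (𝓝 0) →
      Tendsto (fun x => -f x + -f (-x)) atTop (𝓝 0) := fun hf => by
    simpa [add_comm] using hf.neg
  have h1 : (fun x => -hPar γ t x) = dxInv (reMulConj U h) :=
    eq_dxInv_of_hasDerivAt (fun x => by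
      refine (hasDerivAt_hPar hT isOpen_univ hγ he ht (mem_univ x)).fun_neg.congr_deriv ?_
      rw [neg_neg, ← hU, ← hh]
      rfl) (hneg hpar)
  have hw : ∀ x, opJ U h x = omegaVar γ e₁ e₂ t x := fun x => by
    rw [opJ_eq_quadOp, quadOp_apply, LinearMap.id_apply, ← h1, opD_apply, hh', hU',
      omegaVar_eq hT isOpen_univ hγ he ht (mem_univ x)]
    push_cast
    ring
  have hw' : (opJ U h : ℝ → ℂ) = omegaVar γ e₁ e₂ t := funext hw
  have h2 : (fun x => -omegaZero e₁ e₂ t x) = dxInv (imMulConj U (opJ U h)) :=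
    eq_dxInv_of_hasDerivAt (fun x => by
      refine (hasDerivAt_omegaZero hT isOpen_univ hγ he ht (mem_univ x)).fun_neg.congr_deriv ?_
      rw [neg_neg, ← hU, ← hw]
      rfl) (hneg hzero)
  refine ⟨hw, fun x => ?_⟩
  have h3 : opH U (opJ U h) x = deriv (opJ U h) x +
      Complex.I * U x * (dxInv (imMulConj U (opJ U h)) x : ℂ) := opH_apply _ _ _
  rw [h3, ← h2, hw', hU', deriv_uVar hT isOpen_univ hγ he ht (mem_univ x)]
  push_cast
  ring

end Flow

/-- Composing the two factorisations gives `ℛ² = (ℋℐ⁻¹)(-ℐ𝒥) = -ℋ𝒥`. -/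
theorem opH_opJ_eq_neg_opR_opR (u f : Sch) : opH u (opJ u f) = -opR u (opR u f) := by
  rw [opR_eq_opH_symm u (opR u f), opR_eq_neg_opI_opJ, map_neg, map_neg, neg_neg,
    LinearEquiv.symm_apply_apply]

end HasimotoFlow

end

theorem mainTheorem5 :
    -- every inelastic timelike flow, with `D_x⁻¹` standing for an antiderivative
    (∀ (T X : Set ℝ), IsOpen T → IsOpen X → ∀ γ e₁ e₂ : ℝ → ℝ → HasimotoFlow.Mink,
      HasimotoFlow.IsInelasticTimelikeFlow T X γ →
      HasimotoFlow.IsParallelFrame T X γ e₁ e₂ →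
      ∀ t ∈ T,
        (fun x => deriv (fun s => HasimotoFlow.uVar γ e₁ e₂ s x) t) ∈
          HasimotoFlow.valH X (HasimotoFlow.uVar γ e₁ e₂ t) (HasimotoFlow.omegaVar γ e₁ e₂ t) ∧
        HasimotoFlow.omegaVar γ e₁ e₂ t ∈
          HasimotoFlow.valJ X (HasimotoFlow.uVar γ e₁ e₂ t) (HasimotoFlow.hPerp γ e₁ e₂ t) ∧
        ∃ g ∈ HasimotoFlow.valR X (HasimotoFlow.uVar γ e₁ e₂ t) (HasimotoFlow.hPerp γ e₁ e₂ t),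
          (fun x => -deriv (fun s => HasimotoFlow.uVar γ e₁ e₂ s x) t) ∈
            HasimotoFlow.valR X (HasimotoFlow.uVar γ e₁ e₂ t) g) ∧
    -- flows of infinite curves with rapidly decreasing `u` and `h_⊥`
    (∀ (T : Set ℝ), IsOpen T → ∀ γ e₁ e₂ : ℝ → ℝ → HasimotoFlow.Mink,
      HasimotoFlow.IsInelasticTimelikeFlow T Set.univ γ →
      HasimotoFlow.IsParallelFrame T Set.univ γ e₁ e₂ →
      ∀ U h : ℝ → HasimotoFlow.Sch,
      (∀ t ∈ T, ∀ x, U t x = HasimotoFlow.uVar γ e₁ e₂ t x) →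
      (∀ t ∈ T, ∀ x, h t x = HasimotoFlow.hPerp γ e₁ e₂ t x) →
      (∀ t ∈ T, Filter.Tendsto
        (fun x => HasimotoFlow.hPar γ t x + HasimotoFlow.hPar γ t (-x)) Filter.atTop (nhds 0)) →
      (∀ t ∈ T, Filter.Tendsto
        (fun x => HasimotoFlow.omegaZero e₁ e₂ t x + HasimotoFlow.omegaZero e₁ e₂ t (-x))
        Filter.atTop (nhds 0)) →
      ∀ t ∈ T, ∃ w : HasimotoFlow.Sch,
        (∀ x, w x = HasimotoFlow.omegaVar γ e₁ e₂ t x) ∧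
        w = HasimotoFlow.opJ (U t) (h t) ∧
        (∀ x, deriv (fun s => HasimotoFlow.uVar γ e₁ e₂ s x) t = HasimotoFlow.opH (U t) w x) ∧
        (∀ x, deriv (fun s => HasimotoFlow.uVar γ e₁ e₂ s x) t =
          -HasimotoFlow.opR (U t) (HasimotoFlow.opR (U t) (h t)) x)) ∧
    -- `ℋ` and `𝒥`
    HasimotoFlow.IsHamiltonian HasimotoFlow.opH ∧
    HasimotoFlow.IsSymplectic HasimotoFlow.opJ ∧
    HasimotoFlow.CompatibleSymplectic HasimotoFlow.opH HasimotoFlow.opJ ∧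
    HasimotoFlow.IsU1Invariant HasimotoFlow.opH ∧
    HasimotoFlow.IsU1Invariant HasimotoFlow.opJ ∧
    -- `ℐ`
    HasimotoFlow.IsHamiltonian (fun _ => HasimotoFlow.opI.toLinearMap) ∧
    HasimotoFlow.Compatible HasimotoFlow.opH (fun _ => HasimotoFlow.opI.toLinearMap) ∧
    HasimotoFlow.CompatibleSymplectic (fun _ => HasimotoFlow.opI.toLinearMap) HasimotoFlow.opJ ∧
    (∀ u f : HasimotoFlow.Sch,
      HasimotoFlow.opH u (HasimotoFlow.opI.symm f) = -HasimotoFlow.opI (HasimotoFlow.opJ u f)) ∧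
    (∀ u f : HasimotoFlow.Sch,
      HasimotoFlow.opJ u (HasimotoFlow.opI f) = -HasimotoFlow.opI.symm (HasimotoFlow.opH u f)) ∧
    -- `ℛ`
    (∀ u f : HasimotoFlow.Sch,
      HasimotoFlow.opR u f = HasimotoFlow.opH u (HasimotoFlow.opI.symm f) ∧
      HasimotoFlow.opR u f = -HasimotoFlow.opI (HasimotoFlow.opJ u f)) ∧
    HasimotoFlow.IsU1Invariant HasimotoFlow.opR ∧
    HasimotoFlow.IsHereditary HasimotoFlow.opR ∧
    ∀ n : ℕ, HasimotoFlow.IsRecursionOperator HasimotoFlow.opR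
      (fun u => (HasimotoFlow.opR u ^ n) (HasimotoFlow.opI u)) := by
  refine ⟨fun T X hT hX γ e₁ e₂ hγ he t ht => HasimotoFlow.flow_equations hT hX hγ he ht,
    fun T hT γ e₁ e₂ hγ he U h hU hh hpar hzero t ht => ?_,
    HasimotoFlow.isHamiltonian_opH, HasimotoFlow.isSymplectic_opJ HasimotoFlow.opJ_injective, ?_,
    HasimotoFlow.isU1Invariant_opH, HasimotoFlow.isU1Invariant_opJ,
    HasimotoFlow.isHamiltonian_opI, HasimotoFlow.isHamiltonian_opH_add_opI, ?_,
    HasimotoFlow.opH_opI_symm, HasimotoFlow.opJ_opI,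
    fun u f => ⟨HasimotoFlow.opR_eq_opH_symm u f, HasimotoFlow.opR_eq_neg_opI_opJ u f⟩,
    HasimotoFlow.isU1Invariant_opR, HasimotoFlow.isHereditary_opR,
    HasimotoFlow.isRecursionOperator_opR⟩
  · obtain ⟨h1, h2⟩ := HasimotoFlow.flow_equations_schwartz hT hγ he ht (hU t ht) (hh t ht)
      (hpar t ht) (hzero t ht)
    refine ⟨_, h1, rfl, h2, fun x => ?_⟩
    rw [h2, HasimotoFlow.opH_opJ_eq_neg_opR_opR]
    rfl
  · intro c₁ c₂
    simpa [LinearMap.smul_comp] using HasimotoFlow.isHamiltonianFraction_opH_opI_opJ HasimotoFlow.opJ_injective 0 c₁ c₂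
  · intro c₁ c₂
    simpa [LinearMap.smul_comp] using HasimotoFlow.isHamiltonianFraction_opH_opI_opJ HasimotoFlow.opJ_injective c₁ 0 c₂
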